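/- **Setting.** Let $n\ge 0$, let $\alpha_j(t)\in\mathbb D$ $(0\le j\le n-1)$ and $\tau_n(t)\in\mathbb S^1$ for all $t\in\mathbb R$, put $\rho_j=(1-|\alpha_j|^2)^{1/2}$, and let $$\mathrm G=\mathrm G_0\mathrm G_1\cdots \mathrm G_n,\qquad \mathrm G_j=\operatorname{diag}\Big(\mathrm I_j,\begin{pmatrix}\overline{\alpha}_j&\rho_j\\ \rho_j&-\alpha_j\end{pmatrix},\mathrm I_{n-j-1}\Big)\ (j<n),\qquad \mathrm G_n=\operatorname{diag}(\mathrm I_n,\overline{\tau}_n),$$ an $(n+1)\times(n+1)$ unitary upper Hessenberg matrix with positive subdiagonal. Assume that $\mathrm G$ is a differentiable function of $t\in\mathbb R$. Fix $\zeta\in\mathbb S^1$ and a square root $\zeta^{1/2}$ of $\zeta$, with $\zeta^{-1/2}=1/\zeta^{1/2}$. Set $\tau_n(\zeta)=\tau_n$ and $$\tau_j(\zeta)=\frac{\overline\zeta\,\alpha_j+\tau_{j+1}(\zeta)}{\overline{\alpha}_j\,\tau_{j+1}(\zeta)+\overline\zeta}\qquad(j=n-1,\dots,0).$$ Let $c:\mathbb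 R\to(0,\infty)$ be any differentiable function (a normalization; e.g. $c\equiv1$), put $\alpha_{-1}:=-1$, and, for those $t$ for which $\zeta$ is not an eigenvalue of $\mathrm G$, define $$\beta_0(\zeta)=\frac{c}{\zeta^{-1/2}-\tau_0(\zeta)\,\zeta^{1/2}},\qquad \beta_j(\zeta)=\frac1{\beta_{j-1}(\zeta)}\cdot\frac1{\overline\zeta+\tau_{j-1}(\zeta)\,\overline{\alpha_{j-2}}}\cdot\frac1{1-\overline{\tau_{j-1}(\zeta)}\,\alpha_{j-1}}\quad(1\le j\le n).$$ Let $\mathrm A$ be $\zeta^{1/2}$ times the $(n+1)\times(n+1)$ lower bidiagonal matrix with diagonal entries $\overline{\beta_0(\zeta)},\dots,\overline{\beta_n(\zeta)}$ and all subdiagonal entries $-1$, and let $\mathrm K=(\mathrm A-\mathrm A^*)/(2i)$. Put $K_+=\{t:\mathrm K>\mathrm O\}$ and $K_-=\{t:\mathrm K<\mathrm O\}$ (positive, respectively negative, definite), $$x_j=\frac{\mathrm d}{\mathrm dt}\operatorname{Re}\big(\zeta^{-1/2}\beta_j(\zeta)\big),\qquad y_j=\frac{\mathrm d}{\mathrm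 dt}\operatorname{Im}\big(\zeta^{-1/2}\beta_j(\zeta)\big),$$ and let $I_{++}$, $I_{-+}$, $I_{--}$, $I_{+-}$ be the sets of those $t$ such that for all $j\in\{0,\dots,n\}$, respectively, $x_j>0$ and $y_j>0$; $x_j<0$ and $y_j>0$; $x_j<0$ and $y_j<0$; $x_j>0$ and $y_j<0$. **Theorem.** Let $J\subseteq\mathbb R$ be an interval with more than one point such that $\zeta$ is not an eigenvalue of $\mathrm G(t)$ for any $t\in J$. (a) If $J\subseteq(I_{++}\cap K_+)\cup(I_{-+}\cap K_-)$, then all eigenvalues of $\mathrm G$ move strictly counterclockwise along $\mathbb S^1$ as $t$ increases on $J$. (b) If $J\subseteq(I_{--}\cap K_+)\cup(I_{+-}\cap K_-)$, then all eigenvalues of $\mathrm G$ move strictly clockwise along $\mathbb S^1$ as $t$ increases on $J$. Here "move strictly counterclockwise on $J$" means: there are differentiable functions $\theta_0,\dots,\theta_n:J\to\mathbb R$ such that for every $t\in J$ the eigenvalues of $\mathrm G(t)$, listed with multiplicity, are $e^{i\theta_0(t)},\dots,e^{i\theta_n(t)}$, and every $\theta_j$ is strictly increasing on $J$ with $\theta_j'>0$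 on $J$. "Strictly clockwise" means the same with strictly decreasing $\theta_j$ and $\theta_j'<0$. -/

import Mathlib

open scoped ComplexConjugate ComplexOrder

noncomputable section

namespace POPUC

/-- The block diagonal matrix `diag(I_j, Θ(α_j), I_{n-j-1})` of order `n+1` (for `j < n`), where
`Θ(α) = [[conj α, ρ], [ρ, -α]]` and `ρ = (1 - |α|²)^{1/2}`. -/
def blockMatrix (n : ℕ) (α : ℕ → ℂ) (j : ℕ) : Matrix (Fin (n + 1)) (Fin (n + 1)) ℂ :=
  Matrix.of fun i k =>
    if (i : ℕ) = j ∧ (k : ℕ) = j then conj (α j)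
    else if ((i : ℕ) = j ∧ (k : ℕ) = j + 1) ∨ ((i : ℕ) = j + 1 ∧ (k : ℕ) = j) then
      ((Real.sqrt (1 - ‖α j‖ ^ 2) : ℝ) : ℂ)
    else if (i : ℕ) = j + 1 ∧ (k : ℕ) = j + 1 then -α j
    else if i = k then 1 else 0

/-- The diagonal matrix `diag(I_n, conj τ_n)`. -/
def lastMatrix (n : ℕ) (τ : ℂ) : Matrix (Fin (n + 1)) (Fin (n + 1)) ℂ :=
  Matrix.diagonal fun i => if i = Fin.last n then conj τ else 1

/-- The unitary upper Hessenberg matrix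
`G(α_0, …, α_{n-1}, τ_n) = G_0 G_1 ⋯ G_{n-1} G_n`; only the values `α j`, `j < n`, are used. -/
def hessenberg (n : ℕ) (α : ℕ → ℂ) (τ : ℂ) : Matrix (Fin (n + 1)) (Fin (n + 1)) ℂ :=
  ((List.range n).map (blockMatrix n α)).prod * lastMatrix n τ

/-- The sequence `τ_n(ζ), τ_{n-1}(ζ), …`, i.e. the pseudoreflection coefficients listed by
decreasing index. -/
def pseudoreflectionRev (n : ℕ) (α : ℕ → ℂ) (τ ζ : ℂ) : ℕ → ℂ
  | 0 => τ
  | k + 1 =>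
      (conj ζ * α (n - (k + 1)) + pseudoreflectionRev n α τ ζ k) /
        (conj (α (n - (k + 1))) * pseudoreflectionRev n α τ ζ k + conj ζ)

/-- The pseudoreflection coefficient `τ_j(ζ)`, `0 ≤ j ≤ n`. -/
def pseudoreflection (n : ℕ) (α : ℕ → ℂ) (τ ζ : ℂ) (j : ℕ) : ℂ :=
  pseudoreflectionRev n α τ ζ (n - j)

theorem pseudoreflection_last (n : ℕ) (α : ℕ → ℂ) (τ ζ : ℂ) :
    pseudoreflection n α τ ζ n = τ := by
  simp [pseudoreflection, pseudoreflectionRev]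

theorem pseudoreflection_of_lt (n : ℕ) (α : ℕ → ℂ) (τ ζ : ℂ) {j : ℕ} (hj : j < n) :
    pseudoreflection n α τ ζ j =
      (conj ζ * α j + pseudoreflection n α τ ζ (j + 1)) /
        (conj (α j) * pseudoreflection n α τ ζ (j + 1) + conj ζ) := by
  unfold pseudoreflection
  obtain ⟨k, rfl⟩ : ∃ k, n = j + k + 1 := ⟨n - j - 1, by omega⟩
  have h1 : j + k + 1 - j = k + 1 := by omega
  have h2 : j + k + 1 - (j + 1) = k := by omega
  have h3 : j + k + 1 - (k + 1) = j := by omega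
  rw [h1, h2, pseudoreflectionRev, h3]

/-- `shiftedCoeff α j = α_{j-1}`, with the usual convention `α_{-1} = -1`. -/
def shiftedCoeff (α : ℕ → ℂ) : ℕ → ℂ
  | 0 => -1
  | j + 1 => α j

/-- The numbers `β_j(ζ)`, where `s` is a square root of `ζ` and `c > 0` is the normalization:
`β_0 = c / (s⁻¹ - τ_0(ζ) s)` and, for `j ≥ 1`,
`β_j = 1/β_{j-1} · 1/(conj ζ + τ_{j-1}(ζ) conj α_{j-2}) · 1/(1 - conj τ_{j-1}(ζ) α_{j-1})`,
with `α_{-1} = -1`. -/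
def beta (n : ℕ) (α : ℕ → ℂ) (τ ζ s : ℂ) (c : ℝ) : ℕ → ℂ
  | 0 => (c : ℂ) / (s⁻¹ - pseudoreflection n α τ ζ 0 * s)
  | j + 1 =>
      (1 / beta n α τ ζ s c j) *
        (1 / (conj ζ + pseudoreflection n α τ ζ j * conj (shiftedCoeff α j))) *
        (1 / (1 - conj (pseudoreflection n α τ ζ j) * α j))

/-- The lower bidiagonal matrix `A = ζ^{1/2} · (conj β_j on the diagonal, -1 below it)`. -/
def matA (n : ℕ) (s : ℂ) (β : ℕ → ℂ) : Matrix (Fin (n + 1)) (Fin (n + 1)) ℂ :=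
  Matrix.of fun i k =>
    s * (if i = k then conj (β i) else if (i : ℕ) = (k : ℕ) + 1 then -1 else 0)

/-- The skew part `K = (A - A*) / (2i)` of the Toeplitz decomposition `A = H + iK`. -/
def matK (n : ℕ) (s : ℂ) (β : ℕ → ℂ) : Matrix (Fin (n + 1)) (Fin (n + 1)) ℂ :=
  (1 / (2 * Complex.I)) • (matA n s β - (matA n s β).conjTranspose)

/-- `K_+ = {t : K(t) > O}`, for a `t`-dependent family `β`. -/
def Kpos (n : ℕ) (s : ℂ) (β : ℝ → ℕ → ℂ) : Set ℝ := {t | (matK n s (β t)).PosDef}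

/-- `K_- = {t : K(t) < O}`. -/
def Kneg (n : ℕ) (s : ℂ) (β : ℝ → ℕ → ℂ) : Set ℝ := {t | (-matK n s (β t)).PosDef}

/-- `x_j(t) = d/dt Re(ζ^{-1/2} β_j)`. -/
def xDeriv (s : ℂ) (β : ℝ → ℕ → ℂ) (j : ℕ) (t : ℝ) : ℝ :=
  deriv (fun u : ℝ => (s⁻¹ * β u j).re) t

/-- `y_j(t) = d/dt Im(ζ^{-1/2} β_j)`. -/
def yDeriv (s : ℂ) (β : ℝ → ℕ → ℂ) (j : ℕ) (t : ℝ) : ℝ :=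
  deriv (fun u : ℝ => (s⁻¹ * β u j).im) t

/-- `I_{++}`. -/
def Ipp (n : ℕ) (s : ℂ) (β : ℝ → ℕ → ℂ) : Set ℝ :=
  {t | ∀ j ≤ n, 0 < xDeriv s β j t ∧ 0 < yDeriv s β j t}

/-- `I_{-+}`. -/
def Imp (n : ℕ) (s : ℂ) (β : ℝ → ℕ → ℂ) : Set ℝ :=
  {t | ∀ j ≤ n, xDeriv s β j t < 0 ∧ 0 < yDeriv s β j t}

/-- `I_{--}`. -/
def Imm (n : ℕ) (s : ℂ) (β : ℝ → ℕ → ℂ) : Set ℝ :=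
  {t | ∀ j ≤ n, xDeriv s β j t < 0 ∧ yDeriv s β j t < 0}

/-- `I_{+-}`. -/
def Ipm (n : ℕ) (s : ℂ) (β : ℝ → ℕ → ℂ) : Set ℝ :=
  {t | ∀ j ≤ n, 0 < xDeriv s β j t ∧ yDeriv s β j t < 0}

/-- `θ` is a system of arguments for the eigenvalues (listed with multiplicity) of `M t`, `t ∈ J`,
depending differentiably on `t`. -/
def IsEigenvalueArgument {m : ℕ} (M : ℝ → Matrix (Fin m) (Fin m) ℂ) (J : Set ℝ)
    (θ : Fin m → ℝ → ℝ) : Prop :=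
  (∀ j, DifferentiableOn ℝ (θ j) J) ∧
    ∀ t ∈ J, (M t).charpoly =
      ∏ j, (Polynomial.X - Polynomial.C (Complex.exp ((θ j t : ℂ) * Complex.I)))

/-- All eigenvalues of `M t` lie on the unit circle for `t ∈ J` and move strictly counterclockwise
as `t` increases on the interval `J`: they have differentiable arguments, which are strictly
increasing, with positive velocity. -/
def MoveCounterclockwiseOn {m : ℕ} (M : ℝ → Matrix (Fin m) (Fin m) ℂ) (J : Set ℝ) : Prop :=
  ∃ θ : Fin m → ℝ → ℝ, IsEigenvalueArgument M J θ ∧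
    ∀ j, StrictMonoOn (θ j) J ∧ ∀ t ∈ J, 0 < derivWithin (θ j) J t

/-- All eigenvalues of `M t` lie on the unit circle for `t ∈ J` and move strictly clockwise as `t`
increases on the interval `J`. -/
def MoveClockwiseOn {m : ℕ} (M : ℝ → Matrix (Fin m) (Fin m) ℂ) (J : Set ℝ) : Prop :=
  ∃ θ : Fin m → ℝ → ℝ, IsEigenvalueArgument M J θ ∧
    ∀ j, StrictAntiOn (θ j) J ∧ ∀ t ∈ J, derivWithin (θ j) J t < 0

end POPUC

end

/-! ### Pseudoreflection coefficients and pivots -/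

namespace POPUC
open Matrix

/-! Write N = 1 - conj ζ G. Unitarity of G gives N N* = N + N*, so the inverse of N has Hermitian
part 1/2 and can be written (1 + iW)/2 with W Hermitian (`cayley`). An eigenvalue μ of W corresponds
to the eigenvalue of G with argument arg ζ + π - 2 arctan μ (`exp_angle`), so eigenvalues of G turn
counterclockwise exactly when the μ decrease.

The structural fact is `exists_congruence`: Aᵀ = X N⁻¹ X* for an invertible lower bidiagonal X.
Hence Aᵀ + (Aᵀ)* = XX* is positive definite, and the μ are the eigenvalues of the definite pencil
formed by the skew and Hermitian parts of Aᵀ. The parameter t enters this pencil only through the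
diagonal, in the numbers ζ^{-1/2} β_j. Bidiagonality also turns the kernel equation into a
three-term recurrence, so every μ is simple and has a kernel vector v with first entry 1 that
depends continuously on μ and β (`exists_spectral_data`, `continuousWithinAt_kerVec`).

First-order perturbation then gives μ' = -q Σ |v_j|² (y_j + μ x_j) with q > 0
(`hasDerivWithinAt_pencil`). It is obtained from an exact difference identity (`pencil_difference`),
so the eigenvectors need only be continuous; continuity of μ comes from
`continuousWithinAt_sorted_roots`. By a Rayleigh quotient, K > 0 forces all μ > 0 and K < 0 forces
all μ < 0. In each of the four sign regions, all y_j + μ x_j therefore have the same sign, which is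
the sign of the angular velocity. -/

theorem norm_pseudoreflection {n : ℕ} {α : ℕ → ℂ} {τ ζ : ℂ} (hα : ∀ j < n, ‖α j‖ < 1)
    (hτ : ‖τ‖ = 1) (hζ : ‖ζ‖ = 1) {j : ℕ} (hj : j ≤ n) :
    ‖pseudoreflection n α τ ζ j‖ = 1 := by
  induction hj using Nat.decreasingInduction with
  | self => rwa [pseudoreflection_last]
  | of_succ j hj ih =>
    rw [pseudoreflection_of_lt n α τ ζ hj]
    set w := pseudoreflection n α τ ζ (j + 1)
    have hw : w * conj w = 1 := by rw [Complex.mul_conj']; simp [ih]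
    have hz : ζ * conj ζ = 1 := by rw [Complex.mul_conj']; simp [hζ]
    -- The denominator is a unimodular multiple of the conjugate of the numerator, so the quotient
    -- has modulus 1 once it is nonzero; |α_j| < 1 excludes zero.
    have h1 : conj (α j) * w + conj ζ = conj ζ * w * conj (conj ζ * α j + w) := by
      simp only [map_add, map_mul, Complex.conj_conj]
      linear_combination (-conj ζ) * hw - (w * conj (α j)) * hz
    have h2 : ‖conj (α j) * w + conj ζ‖ = ‖conj ζ * α j + w‖ := by
      rw [h1, norm_mul, norm_mul, Complex.norm_conj, Complex.norm_conj, ih, hζ, one_mul, one_mul]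
    rw [norm_div, h2, div_self]
    rw [← h2]
    intro h0
    have h3 : ‖conj (α j) * w‖ = ‖conj ζ‖ := by
      rw [norm_eq_zero, add_eq_zero_iff_eq_neg] at h0
      rw [h0, norm_neg]
    rw [norm_mul, ih, Complex.norm_conj, Complex.norm_conj, hζ, mul_one] at h3
    exact absurd h3 (hα j hj).ne

/-- The coefficient `conj ζ * conj τ_j(ζ)`. -/
noncomputable def omega (n : ℕ) (α : ℕ → ℂ) (τ ζ : ℂ) (j : ℕ) : ℂ :=
  conj ζ * conj (pseudoreflection n α τ ζ j)

/-- The number `1 + α_{j-1} conj ζ conj τ_j(ζ)`. -/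
noncomputable def pivot (n : ℕ) (α : ℕ → ℂ) (τ ζ : ℂ) (j : ℕ) : ℂ :=
  1 + shiftedCoeff α j * omega n α τ ζ j

/-- The complementary parameter `ρ_j`. -/
noncomputable def rho (α : ℕ → ℂ) (j : ℕ) : ℝ := Real.sqrt (1 - ‖α j‖ ^ 2)

section Coefficients

variable {n : ℕ} {α : ℕ → ℂ} {τ ζ : ℂ}

theorem rho_pos {j : ℕ} (h : ‖α j‖ < 1) : 0 < rho α j :=
  Real.sqrt_pos.2 (by nlinarith [norm_nonneg (α j)])

theorem rho_sq {j : ℕ} (h : ‖α j‖ < 1) : (rho α j : ℂ) ^ 2 = 1 - α j * conj (α j) := by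
  rw [Complex.mul_conj', ← Complex.ofReal_pow, rho, Real.sq_sqrt (by nlinarith [norm_nonneg (α j)])]
  push_cast; ring

theorem norm_omega (hα : ∀ j < n, ‖α j‖ < 1) (hτ : ‖τ‖ = 1) (hζ : ‖ζ‖ = 1) {j : ℕ} (hj : j ≤ n) :
    ‖omega n α τ ζ j‖ = 1 := by
  simp [omega, norm_pseudoreflection hα hτ hζ hj, hζ]

theorem pivot_succ_ne_zero (hα : ∀ j < n, ‖α j‖ < 1) (hτ : ‖τ‖ = 1) (hζ : ‖ζ‖ = 1) {j : ℕ}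
    (hj : j < n) : pivot n α τ ζ (j + 1) ≠ 0 := by
  intro h0
  have h1 : ‖α j * omega n α τ ζ (j + 1)‖ = ‖(1 : ℂ)‖ := by
    rw [pivot, shiftedCoeff, add_comm, add_eq_zero_iff_eq_neg] at h0
    rw [h0, norm_neg]
  rw [norm_mul, norm_omega hα hτ hζ hj, norm_one, mul_one] at h1
  exact absurd h1 (hα j hj).ne

theorem conj_pseudoreflection (hζ : ‖ζ‖ = 1) {j : ℕ} (hj : j < n) :
    conj (pseudoreflection n α τ ζ j) =
      (conj (α j) + omega n α τ ζ (j + 1)) / pivot n α τ ζ (j + 1) := by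
  have hz : ζ * conj ζ = 1 := by rw [Complex.mul_conj']; simp [hζ]
  have hz0 : ζ ≠ 0 := left_ne_zero_of_mul_eq_one hz
  rw [pseudoreflection_of_lt n α τ ζ hj, pivot, omega, shiftedCoeff]
  set w := pseudoreflection n α τ ζ (j + 1)
  have h1 : conj ((conj ζ * α j + w)) = ζ * (conj (α j) + conj ζ * conj w) := by
    simp only [map_add, map_mul, Complex.conj_conj]; linear_combination (-conj w) * hz
  have h2 : conj (conj (α j) * w + conj ζ) = ζ * (1 + α j * (conj ζ * conj w)) := by
    simp only [map_add, map_mul, Complex.conj_conj]; linear_combination (-α j * conj w) * hz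
  rw [map_div₀, h1, h2, mul_div_mul_left _ _ hz0]

/-- Rewrites the last factor in the recursion for β through ρ and the pivots, which makes that
recursion comparable with the one for `scaling`. -/
theorem one_sub_conj_pseudoreflection (hα : ∀ j < n, ‖α j‖ < 1) (hτ : ‖τ‖ = 1) (hζ : ‖ζ‖ = 1)
    {j : ℕ} (hj : j < n) :
    1 - conj (pseudoreflection n α τ ζ j) * α j = (rho α j : ℂ) ^ 2 / pivot n α τ ζ (j + 1) := by
  have hp := pivot_succ_ne_zero hα hτ hζ hj
  rw [conj_pseudoreflection hζ hj, rho_sq (hα j hj), eq_div_iff hp]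
  field_simp
  rw [pivot, shiftedCoeff]; ring

end Coefficients

/-! ### Row action of the factors, unitarity, and tail products -/

section Blocks

variable {n : ℕ} (α : ℕ → ℂ)

/-- The standard unit row vector with index `i`. -/
noncomputable def unitVec (n i : ℕ) : Fin (n + 1) → ℂ := fun k => if (k : ℕ) = i then 1 else 0

theorem unitVec_eq_single {i : ℕ} (h : i < n + 1) : unitVec n i = Pi.single ⟨i, h⟩ 1 := by
  ext k; simp [unitVec, Pi.single_apply, Fin.ext_iff]

theorem unitVec_vecMul {i : ℕ} (h : i < n + 1) (M : Matrix (Fin (n + 1)) (Fin (n + 1)) ℂ) :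
    unitVec n i ᵥ* M = M ⟨i, h⟩ := by
  rw [unitVec_eq_single h, single_one_vecMul]; rfl

theorem unitVec_vecMul_blockMatrix {j : ℕ} (hj : j < n) :
    unitVec n j ᵥ* blockMatrix n α j =
      conj (α j) • unitVec n j + (rho α j : ℂ) • unitVec n (j + 1) := by
  rw [unitVec_vecMul (by omega)]
  ext k
  rcases k with ⟨k, hk⟩
  rcases eq_or_ne k j with rfl | h1
  · simp [blockMatrix, unitVec, rho]
  rcases eq_or_ne k (j + 1) with rfl | h2
  · simp [blockMatrix, unitVec, rho]
  simp [blockMatrix, unitVec, h1, h2, h1.symm]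

theorem unitVec_succ_vecMul_blockMatrix {j : ℕ} (hj : j < n) :
    unitVec n (j + 1) ᵥ* blockMatrix n α j =
      (rho α j : ℂ) • unitVec n j - α j • unitVec n (j + 1) := by
  rw [unitVec_vecMul (by omega)]
  ext k
  rcases k with ⟨k, hk⟩
  rcases eq_or_ne k j with rfl | h1
  · simp [blockMatrix, unitVec, rho]
  rcases eq_or_ne k (j + 1) with rfl | h2
  · simp [blockMatrix, unitVec, rho]
  simp [blockMatrix, unitVec, h1, h2, h2.symm]

theorem vecMul_blockMatrix_of_eq_zero {j : ℕ} {f : Fin (n + 1) → ℂ}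
    (hf : ∀ k : Fin (n + 1), (k : ℕ) = j ∨ (k : ℕ) = j + 1 → f k = 0) :
    f ᵥ* blockMatrix n α j = f := by
  ext k
  rw [vecMul, dotProduct, Finset.sum_eq_single k]
  · by_cases hk : (k : ℕ) = j ∨ (k : ℕ) = j + 1
    · simp [hf k hk]
    · push Not at hk
      simp [blockMatrix, hk.1, hk.2]
  · intro i _ hik
    by_cases hi : (i : ℕ) = j ∨ (i : ℕ) = j + 1
    · simp [hf i hi]
    · push Not at hi
      simp [blockMatrix, hi.1, hi.2, hik]
  · simp

theorem blockMatrix_conjTranspose (j : ℕ) :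
    (blockMatrix n α j)ᴴ = blockMatrix n (fun i => conj (α i)) j := by
  ext i k
  simp only [blockMatrix, conjTranspose_apply, of_apply, Complex.norm_conj, Fin.ext_iff]
  split_ifs <;> first | omega | simp

theorem blockMatrix_mul_conjTranspose {j : ℕ} (hj : j < n) (h : ‖α j‖ < 1) :
    blockMatrix n α j * (blockMatrix n α j)ᴴ = 1 := by
  have hr := rho_sq h
  have hr' : rho (fun i => conj (α i)) j = rho α j := by simp [rho]
  have h1 := unitVec_vecMul_blockMatrix α hj
  have h2 := unitVec_succ_vecMul_blockMatrix α hj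
  have h3 := unitVec_vecMul_blockMatrix (fun i => conj (α i)) hj
  have h4 := unitVec_succ_vecMul_blockMatrix (fun i => conj (α i)) hj
  rw [hr'] at h3 h4
  rw [blockMatrix_conjTranspose]
  suffices ∀ i < n + 1, unitVec n i ᵥ* (blockMatrix n α j * blockMatrix n (fun i => conj (α i)) j) =
      unitVec n i by
    ext i k
    have := congrFun (this i i.2) k
    rw [unitVec_vecMul i.2] at this
    rw [this, one_apply]; simp [unitVec, Fin.ext_iff, eq_comm]
  intro i hi
  rw [← vecMul_vecMul]
  by_cases hij : i = j
  · subst hij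
    rw [h1, add_vecMul, smul_vecMul, smul_vecMul, h3, h4]
    ext k
    simp only [Pi.add_apply, Pi.sub_apply, Pi.smul_apply, smul_eq_mul, Complex.conj_conj]
    linear_combination unitVec n i k * hr
  by_cases hij' : i = j + 1
  · subst hij'
    rw [h2, sub_vecMul, smul_vecMul, smul_vecMul, h3, h4]
    ext k
    simp only [Pi.add_apply, Pi.sub_apply, Pi.smul_apply, smul_eq_mul, Complex.conj_conj]
    linear_combination unitVec n (j + 1) k * hr
  have h5 : ∀ k : Fin (n + 1), (k : ℕ) = j ∨ (k : ℕ) = j + 1 → unitVec n i k = 0 := by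
    intro k hk; simp only [unitVec, ite_eq_right_iff]; omega
  rw [vecMul_blockMatrix_of_eq_zero _ h5, vecMul_blockMatrix_of_eq_zero _ h5]

variable {α}

theorem hessenberg_mul_conjTranspose {τ : ℂ} (hα : ∀ j < n, ‖α j‖ < 1) (hτ : ‖τ‖ = 1) :
    hessenberg n α τ * (hessenberg n α τ)ᴴ = 1 := by
  have h1 : lastMatrix n τ * (lastMatrix n τ)ᴴ = 1 := by
    rw [lastMatrix, diagonal_conjTranspose, diagonal_mul_diagonal, ← diagonal_one]
    congr 1; ext i
    have := Complex.conj_mul' τ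
    by_cases h : i = Fin.last n <;> simp_all
  have h2 : ∀ k ≤ n, ((List.range k).map (blockMatrix n α)).prod *
      (((List.range k).map (blockMatrix n α)).prod)ᴴ = 1 := by
    intro k hk
    induction k with
    | zero => simp
    | succ k ih =>
      rw [List.range_succ, List.map_append, List.prod_append]
      simp only [List.map_cons, List.map_nil, List.prod_cons, List.prod_nil, mul_one]
      rw [conjTranspose_mul, Matrix.mul_assoc, ← Matrix.mul_assoc (blockMatrix n α k),
        blockMatrix_mul_conjTranspose α hk (hα k hk), Matrix.one_mul, ih (by omega)]
  rw [hessenberg, conjTranspose_mul, Matrix.mul_assoc, ← Matrix.mul_assoc (lastMatrix n τ), h1,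
    Matrix.one_mul, h2 n le_rfl]

/-- The product `G_j G_{j+1} ⋯ G_n` for `j = n - k`. -/
noncomputable def tailProd (n : ℕ) (α : ℕ → ℂ) (τ : ℂ) : ℕ → Matrix (Fin (n + 1)) (Fin (n + 1)) ℂ
  | 0 => lastMatrix n τ
  | k + 1 => blockMatrix n α (n - (k + 1)) * tailProd n α τ k

theorem hessenberg_eq_mul_tailProd (τ : ℂ) {j : ℕ} (hj : j ≤ n) :
    hessenberg n α τ = ((List.range j).map (blockMatrix n α)).prod * tailProd n α τ (n - j) := by
  induction hj using Nat.decreasingInduction with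
  | self => simp [hessenberg, tailProd]
  | of_succ j hj ih =>
    obtain ⟨k, rfl⟩ : ∃ k, n = j + k + 1 := ⟨n - j - 1, by omega⟩
    have h1 : j + k + 1 - j = k + 1 := by omega
    have h2 : j + k + 1 - (j + 1) = k := by omega
    have h3 : j + k + 1 - (k + 1) = j := by omega
    rw [ih, h1, h2, tailProd, h3, List.range_succ, List.map_append, List.prod_append]
    simp [Matrix.mul_assoc]

theorem unitVec_vecMul_tailProd (τ : ℂ) {j k : ℕ} (hk : k < n - j) :
    unitVec n j ᵥ* tailProd n α τ k = unitVec n j := by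
  induction k with
  | zero =>
    ext i
    simp only [tailProd, lastMatrix, vecMul_diagonal, unitVec, Fin.ext_iff, Fin.val_last]
    split_ifs <;> first | omega | simp
  | succ k ih =>
    rw [tailProd, ← vecMul_vecMul, vecMul_blockMatrix_of_eq_zero, ih (by omega)]
    intro i hi; simp only [unitVec, ite_eq_right_iff]; omega

/-- The left eigenvector equation of the tail G_j ⋯ G_n at ζ is solved in all coordinates after j;
conj τ_j is the residue in coordinate j. This is the linear-algebraic meaning of the recursion for
τ_j. -/
theorem exists_tail_vector {τ ζ : ℂ} (hα : ∀ j < n, ‖α j‖ < 1) (hτ : ‖τ‖ = 1) (hζ : ‖ζ‖ = 1)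
    {j : ℕ} (hj : j ≤ n) :
    ∃ g : Fin (n + 1) → ℂ, (∀ k : Fin (n + 1), (k : ℕ) ≤ j → g k = 0) ∧
      (unitVec n j + g) ᵥ* tailProd n α τ (n - j) =
        ζ • g + conj (pseudoreflection n α τ ζ j) • unitVec n j := by
  have hz : ζ * conj ζ = 1 := by rw [Complex.mul_conj']; simp [hζ]
  induction hj using Nat.decreasingInduction with
  | self =>
    refine ⟨0, by simp, ?_⟩
    rw [Nat.sub_self, tailProd, pseudoreflection_last, lastMatrix]
    ext k
    simp only [add_zero, smul_zero, zero_add, Pi.smul_apply, smul_eq_mul, vecMul_diagonal, unitVec,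
      Fin.ext_iff, Fin.val_last]
    split_ifs <;> simp
  | of_succ j hj ih =>
    obtain ⟨g, hg0, hg⟩ := ih
    have hp := pivot_succ_ne_zero hα hτ hζ hj
    have hT := conj_pseudoreflection (α := α) (τ := τ) hζ hj
    have hr := rho_sq (hα j hj)
    have hω : ζ * omega n α τ ζ (j + 1) = conj (pseudoreflection n α τ ζ (j + 1)) := by
      rw [omega, ← mul_assoc, hz, one_mul]
    have hpiv : pivot n α τ ζ (j + 1) = 1 + α j * omega n α τ ζ (j + 1) := rfl
    set ω := omega n α τ ζ (j + 1)
    set p := pivot n α τ ζ (j + 1)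
    have h1 := unitVec_vecMul_blockMatrix α hj
    have h2 := unitVec_succ_vecMul_blockMatrix α hj
    have h3 : g ᵥ* blockMatrix n α j = g :=
      vecMul_blockMatrix_of_eq_zero α fun k hk => hg0 k (by omega)
    -- The coefficient ω is chosen so that multiplication by G_j produces a multiple of e_{j+1} + g,
    -- to which the induction hypothesis applies; then ζω = conj τ_{j+1} closes the equation.
    refine ⟨((rho α j : ℂ) / p) • (ω • unitVec n (j + 1) + g), ?_, ?_⟩
    · intro k hk
      simp only [Pi.smul_apply, Pi.add_apply, hg0 k (by omega), unitVec, smul_eq_mul]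
      rw [if_neg (by omega)]; simp
    have h4 : n - j = n - (j + 1) + 1 := by omega
    have h5 : n - (n - (j + 1) + 1) = j := by omega
    rw [h4, tailProd, h5, ← vecMul_vecMul]
    have hj0 : unitVec n j ᵥ* tailProd n α τ (n - (j + 1)) = unitVec n j :=
      unitVec_vecMul_tailProd τ (by omega)
    have h6 : (unitVec n j + ((rho α j : ℂ) / p) • (ω • unitVec n (j + 1) + g)) ᵥ*
        blockMatrix n α j = conj (pseudoreflection n α τ ζ j) • unitVec n j +
          ((rho α j : ℂ) / p) • (unitVec n (j + 1) + g) := by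
      rw [add_vecMul, smul_vecMul, add_vecMul, smul_vecMul, h1, h2, h3]
      ext k
      simp only [Pi.add_apply, Pi.sub_apply, Pi.smul_apply, smul_eq_mul, hT]
      field_simp
      linear_combination unitVec n j k * ω * hr +
        (conj (α j) * unitVec n j k + (rho α j : ℂ) * unitVec n (j + 1) k) * hpiv
    rw [h6, add_vecMul, smul_vecMul, hj0, smul_vecMul, hg]
    ext k
    simp only [Pi.add_apply, Pi.smul_apply, smul_eq_mul, ← hω]
    ring

end Blocks

end POPUC

namespace POPUC
open Matrix

/-! ### Triangular factorization of 1 - conj ζ G and its congruence with Aᵀ -/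

section Congruence

variable {n : ℕ} {α : ℕ → ℂ} {τ ζ s : ℂ}

/-- The sequence `0, ρ_0, ρ_1, …`. -/
noncomputable def shiftedRho (α : ℕ → ℂ) : ℕ → ℝ
  | 0 => 0
  | j + 1 => rho α j

/-- The row scalings turning the triangular factorization of `1 - conj ζ • G` into a congruence. -/
noncomputable def scaling (n : ℕ) (α : ℕ → ℂ) (τ ζ s : ℂ) (c : ℝ) : ℕ → ℂ
  | 0 => ((Real.sqrt c / ‖pivot n α τ ζ 0‖ : ℝ) : ℂ)
  | j + 1 => conj (s / (ζ * rho α j * pivot n α τ ζ j * scaling n α τ ζ s c j))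

theorem vecMul_head_of_eq_zero {f : Fin (n + 1) → ℂ} {j : ℕ}
    (hf : ∀ k : Fin (n + 1), (k : ℕ) ≤ j → f k = 0) :
    f ᵥ* ((List.range j).map (blockMatrix n α)).prod = f := by
  induction j with
  | zero => simp
  | succ j ih =>
    rw [List.range_succ, List.map_append, List.prod_append]
    simp only [List.map_cons, List.map_nil, List.prod_cons, List.prod_nil, mul_one]
    rw [← vecMul_vecMul, ih fun k hk => hf k (by omega),
      vecMul_blockMatrix_of_eq_zero α fun k hk => hf k (by omega)]

/-- Take r = e_i - α_{i-1} g with g the tail vector. The blocks before G_{i-1} fix r, and G_{i-1}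
turns it into ρ_{i-1} e_{i-1} - α_{i-1}(e_i + g); the tail then yields ζg, which cancels against g
in r. For i = 0 the conventions α_{-1} = -1 and `shiftedRho α 0 = 0` cover the missing block, and
the latter makes the truncated index i - 1 harmless. -/
theorem exists_row (hα : ∀ j < n, ‖α j‖ < 1) (hτ : ‖τ‖ = 1) (hζ : ‖ζ‖ = 1) {i : ℕ} (hi : i ≤ n) :
    ∃ r : Fin (n + 1) → ℂ, (∀ k : Fin (n + 1), (k : ℕ) < i → r k = 0) ∧
      (∀ k : Fin (n + 1), (k : ℕ) = i → r k = 1) ∧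
      r ᵥ* (1 - conj ζ • hessenberg n α τ) =
        pivot n α τ ζ i • unitVec n i - (conj ζ * shiftedRho α i) • unitVec n (i - 1) := by
  have hz : ζ * conj ζ = 1 := by rw [Complex.mul_conj']; simp [hζ]
  obtain ⟨g, hg0, hg⟩ := exists_tail_vector hα hτ hζ hi
  refine ⟨unitVec n i - shiftedCoeff α i • g, ?_, ?_, ?_⟩
  · intro k hk
    simp [unitVec, hk.ne, hg0 k hk.le]
  · intro k hk
    simp [unitVec, hk, hg0 k hk.le]
  suffices (unitVec n i - shiftedCoeff α i • g) ᵥ* hessenberg n α τ =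
      (shiftedRho α i : ℂ) • unitVec n (i - 1) - shiftedCoeff α i •
        (ζ • g + conj (pseudoreflection n α τ ζ i) • unitVec n i) by
    rw [vecMul_sub, vecMul_one, vecMul_smul, this]
    ext k
    simp only [Pi.add_apply, Pi.sub_apply, Pi.smul_apply, smul_eq_mul, pivot, omega]
    linear_combination shiftedCoeff α i * g k * hz
  rw [hessenberg_eq_mul_tailProd τ hi, ← vecMul_vecMul]
  cases i with
  | zero =>
    rw [Nat.sub_zero] at hg ⊢
    simpa [shiftedCoeff, shiftedRho, hg] using add_comm _ _
  | succ j =>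
    have h1 := unitVec_succ_vecMul_blockMatrix α hi
    have h3 : g ᵥ* blockMatrix n α j = g :=
      vecMul_blockMatrix_of_eq_zero α fun k hk => hg0 k (by omega)
    have hj0 : unitVec n j ᵥ* tailProd n α τ (n - (j + 1)) = unitVec n j :=
      unitVec_vecMul_tailProd τ (by omega)
    rw [List.range_succ, List.map_append, List.prod_append]
    simp only [List.map_cons, List.map_nil, List.prod_cons, List.prod_nil, mul_one]
    rw [← vecMul_vecMul, vecMul_head_of_eq_zero, sub_vecMul, smul_vecMul, h1, h3]
    · have h6 : (rho α j : ℂ) • unitVec n j - α j • unitVec n (j + 1) - shiftedCoeff α (j + 1) • g =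
          (rho α j : ℂ) • unitVec n j - α j • (unitVec n (j + 1) + g) := by
        rw [shiftedCoeff, smul_add]; abel
      rw [h6, sub_vecMul, smul_vecMul, smul_vecMul, hg, hj0]
      rfl
    · intro k hk
      have : (k : ℕ) ≠ j + 1 := by omega
      simp [unitVec, this, hg0 k (by omega)]

/-- If this pivot vanished, the row with index 0 would be a left null vector of 1 - conj ζ G. The
later pivots are nonzero already because |α_j| < 1. -/
theorem pivot_zero_ne_zero (hα : ∀ j < n, ‖α j‖ < 1) (hτ : ‖τ‖ = 1) (hζ : ‖ζ‖ = 1)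
    (hreg : ζ ∉ spectrum ℂ (hessenberg n α τ)) : pivot n α τ ζ 0 ≠ 0 := by
  have hz : ζ * conj ζ = 1 := by rw [Complex.mul_conj']; simp [hζ]
  intro h0
  obtain ⟨r, -, hr1, hr⟩ := exists_row hα hτ hζ (Nat.zero_le n)
  rw [h0, shiftedRho] at hr
  rw [spectrum.notMem_iff] at hreg
  have h1 : r ᵥ* (algebraMap ℂ (Matrix (Fin (n + 1)) (Fin (n + 1)) ℂ) ζ - hessenberg n α τ) = 0 := by
    have : algebraMap ℂ (Matrix (Fin (n + 1)) (Fin (n + 1)) ℂ) ζ - hessenberg n α τ =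
        ζ • (1 - conj ζ • hessenberg n α τ) := by
      rw [smul_sub, smul_smul, hz, one_smul, Algebra.algebraMap_eq_smul_one]
    rw [this, vecMul_smul, hr]; simp
  have h2 : r = 0 := vecMul_injective_of_isUnit hreg (by simpa using h1)
  have := hr1 0 rfl
  simp [h2] at this

theorem pivot_ne_zero (hα : ∀ j < n, ‖α j‖ < 1) (hτ : ‖τ‖ = 1) (hζ : ‖ζ‖ = 1)
    (hreg : ζ ∉ spectrum ℂ (hessenberg n α τ)) {j : ℕ} (hj : j ≤ n) : pivot n α τ ζ j ≠ 0 := by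
  cases j with
  | zero => exact pivot_zero_ne_zero hα hτ hζ hreg
  | succ j => exact pivot_succ_ne_zero hα hτ hζ hj

theorem scaling_ne_zero (hα : ∀ j < n, ‖α j‖ < 1) (hτ : ‖τ‖ = 1) (hζ : ‖ζ‖ = 1) (hs : s ^ 2 = ζ)
    (hreg : ζ ∉ spectrum ℂ (hessenberg n α τ)) {c : ℝ} (hc : 0 < c) {j : ℕ} (hj : j ≤ n) :
    scaling n α τ ζ s c j ≠ 0 := by
  have hζ0 : ζ ≠ 0 := norm_ne_zero_iff.1 (by rw [hζ]; exact one_ne_zero)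
  have hs0 : s ≠ 0 := by rintro rfl; exact hζ0 (by rw [← hs]; simp)
  induction j with
  | zero =>
    have := pivot_zero_ne_zero hα hτ hζ hreg
    rw [scaling, Complex.ofReal_ne_zero]
    exact (div_pos (Real.sqrt_pos.2 hc) (norm_pos_iff.2 this)).ne'
  | succ j ih =>
    have h1 := pivot_ne_zero hα hτ hζ hreg (j := j) (by omega)
    have h2 : (rho α j : ℂ) ≠ 0 := Complex.ofReal_ne_zero.2 (rho_pos (hα j hj)).ne'
    have h3 := ih (by omega)
    rw [scaling, Ne, map_eq_zero]
    exact div_ne_zero hs0 (mul_ne_zero (mul_ne_zero (mul_ne_zero hζ0 h2) h1) h3)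

/-- The scalings are dictated by the off-diagonal entries of A; this is the check that they also
produce the diagonal. Both sides obey the same recursion, and the normalization c fixes the initial
value. -/
theorem scaling_mul_pivot (hα : ∀ j < n, ‖α j‖ < 1) (hτ : ‖τ‖ = 1) (hζ : ‖ζ‖ = 1) (hs : s ^ 2 = ζ)
    (hreg : ζ ∉ spectrum ℂ (hessenberg n α τ)) {c : ℝ} (hc : 0 < c) {j : ℕ} (hj : j ≤ n) :
    scaling n α τ ζ s c j * conj (scaling n α τ ζ s c j) * pivot n α τ ζ j =
      s⁻¹ * beta n α τ ζ s c j := by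
  have hz : ζ * conj ζ = 1 := by rw [Complex.mul_conj']; simp [hζ]
  have hζ0 : ζ ≠ 0 := left_ne_zero_of_mul_eq_one hz
  have hs0 : s ≠ 0 := by rintro rfl; exact hζ0 (by rw [← hs]; simp)
  have hsn : ‖s‖ = 1 := by
    have : ‖s‖ ^ 2 = 1 := by rw [← norm_pow, hs, hζ]
    exact (pow_eq_one_iff_of_nonneg (norm_nonneg s) two_ne_zero).1 this
  have hss : s * conj s = 1 := by rw [Complex.mul_conj']; simp [hsn]
  induction j with
  | zero =>
    have hp := pivot_zero_ne_zero hα hτ hζ hreg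
    have hp' : conj (pivot n α τ ζ 0) ≠ 0 := (map_ne_zero _).2 hp
    have h1 : conj (pivot n α τ ζ 0) = 1 - ζ * pseudoreflection n α τ ζ 0 := by
      simp [pivot, omega, shiftedCoeff]; ring
    have h2 : s * (s⁻¹ - pseudoreflection n α τ ζ 0 * s) = conj (pivot n α τ ζ 0) := by
      rw [h1, ← hs]; field_simp
    have h4 : (Real.sqrt c : ℂ) ^ 2 = c := by rw [← Complex.ofReal_pow, Real.sq_sqrt hc.le]
    have h5 := Complex.mul_conj' (pivot n α τ ζ 0)
    have h6 : (‖pivot n α τ ζ 0‖ : ℂ) ≠ 0 := Complex.ofReal_ne_zero.2 (norm_ne_zero_iff.2 hp)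
    rw [scaling, beta, Complex.conj_ofReal, inv_mul_eq_div, div_div, mul_comm _ s, h2,
      eq_div_iff hp']
    push_cast
    field_simp
    rw [h4, mul_assoc, h5]; ring
  | succ j ih =>
    have ih := ih (by omega)
    have hp := pivot_ne_zero hα hτ hζ hreg (j := j) (by omega)
    have hp' : conj (pivot n α τ ζ j) ≠ 0 := (map_ne_zero _).2 hp
    have hr : (rho α j : ℂ) ≠ 0 := Complex.ofReal_ne_zero.2 (rho_pos (hα j hj)).ne'
    have ha := scaling_ne_zero hα hτ hζ hs hreg hc (j := j) (by omega)
    have ha' : conj (scaling n α τ ζ s c j) ≠ 0 := (map_ne_zero _).2 ha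
    have hp1 := pivot_succ_ne_zero hα hτ hζ hj
    have h1 : conj ζ + pseudoreflection n α τ ζ j * conj (shiftedCoeff α j) =
        ζ⁻¹ * conj (pivot n α τ ζ j) := by
      simp only [pivot, omega, map_add, map_mul, Complex.conj_conj, map_one]
      field_simp
      linear_combination hz
    have h2 : beta n α τ ζ s c j = s * (scaling n α τ ζ s c j * conj (scaling n α τ ζ s c j) *
        pivot n α τ ζ j) := by
      rw [ih]; field_simp
    have hcs : conj s = s⁻¹ := eq_inv_of_mul_eq_one_right hss
    have hcz : conj ζ = ζ⁻¹ := eq_inv_of_mul_eq_one_right hz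
    rw [scaling, beta, h1, one_sub_conj_pseudoreflection hα hτ hζ hj, h2]
    simp only [map_div₀, map_mul, map_inv₀, inv_inv, Complex.conj_conj, Complex.conj_ofReal, hcs, hcz]
    set a := scaling n α τ ζ s c j
    field_simp
    rw [← hs]

theorem dotProduct_unitVec (f : Fin (n + 1) → ℂ) {i : ℕ} (h : i < n + 1) :
    f ⬝ᵥ unitVec n i = f ⟨i, h⟩ := by
  rw [unitVec_eq_single h, dotProduct_single_one]

/-- The matrices `A` and `(1 - conj ζ • G)⁻¹` are congruent up to transposition. -/
theorem exists_congruence (hα : ∀ j < n, ‖α j‖ < 1) (hτ : ‖τ‖ = 1) (hζ : ‖ζ‖ = 1) (hs : s ^ 2 = ζ)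
    (hreg : ζ ∉ spectrum ℂ (hessenberg n α τ)) {c : ℝ} (hc : 0 < c) :
    ∃ U X : Matrix (Fin (n + 1)) (Fin (n + 1)) ℂ, IsUnit X ∧
      U * (1 - conj ζ • hessenberg n α τ) = X ∧
      U * Xᴴ = (matA n s (beta n α τ ζ s c))ᵀ ∧ X * Xᴴ = U * Xᴴ + (U * Xᴴ)ᴴ := by
  have hz : ζ * conj ζ = 1 := by rw [Complex.mul_conj']; simp [hζ]
  have hsn : ‖s‖ = 1 := by
    have : ‖s‖ ^ 2 = 1 := by rw [← norm_pow, hs, hζ]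
    exact (pow_eq_one_iff_of_nonneg (norm_nonneg s) two_ne_zero).1 this
  have hss : s * conj s = 1 := by rw [Complex.mul_conj']; simp [hsn]
  have hcs : conj s = s⁻¹ := eq_inv_of_mul_eq_one_right hss
  have hζ0 : ζ ≠ 0 := left_ne_zero_of_mul_eq_one hz
  choose r hr0 hr1 hr using fun i : Fin (n + 1) => exists_row hα hτ hζ (Nat.lt_succ_iff.1 i.2)
  set G := hessenberg n α τ
  set a := scaling n α τ ζ s c
  set p := pivot n α τ ζ
  have ha : ∀ i : Fin (n + 1), a i ≠ 0 := fun i =>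
    scaling_ne_zero hα hτ hζ hs hreg hc (Nat.lt_succ_iff.1 i.2)
  have hp : ∀ i : Fin (n + 1), p i ≠ 0 := fun i =>
    pivot_ne_zero hα hτ hζ hreg (Nat.lt_succ_iff.1 i.2)
  let U : Matrix (Fin (n + 1)) (Fin (n + 1)) ℂ := Matrix.of fun i => a i • r i
  let X : Matrix (Fin (n + 1)) (Fin (n + 1)) ℂ := Matrix.of fun i =>
    a i • (p i • unitVec n i - (conj ζ * shiftedRho α i) • unitVec n (i - 1))
  have hUi : ∀ i, U i = a i • r i := fun _ => rfl
  have hXi : ∀ i, X i = a i • (p i • unitVec n i - (conj ζ * shiftedRho α i) • unitVec n (i - 1)) :=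
    fun _ => rfl
  have hUX : U * (1 - conj ζ • G) = X := by
    ext i k
    have : (U * (1 - conj ζ • G)) i = U i ᵥ* (1 - conj ζ • G) := by rw [mul_apply_eq_vecMul]
    rw [this, hUi, smul_vecMul, hr, ← hXi]
  have hG : G * Gᴴ = 1 := hessenberg_mul_conjTranspose hα hτ
  have hXX : X * Xᴴ = U * Xᴴ + (U * Xᴴ)ᴴ := by
    rw [← hUX]
    simp only [conjTranspose_mul, conjTranspose_sub, conjTranspose_one, conjTranspose_smul,
      conjTranspose_conjTranspose, Complex.star_def, Complex.conj_conj]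
    -- The identity N N* = N + N*, which encodes unitarity of G.
    have : (1 - conj ζ • G) * (1 - ζ • Gᴴ) = (1 - ζ • Gᴴ) + (1 - conj ζ • G) := by
      rw [Matrix.sub_mul, Matrix.mul_sub, Matrix.mul_sub, smul_mul_smul_comm, hG, mul_comm, hz]
      simp only [Matrix.one_mul, Matrix.mul_one, one_smul]
      abel
    calc U * (1 - conj ζ • G) * ((1 - ζ • Gᴴ) * Uᴴ)
        = U * ((1 - conj ζ • G) * (1 - ζ • Gᴴ)) * Uᴴ := by simp only [Matrix.mul_assoc]
      _ = _ := by rw [this]; simp only [Matrix.mul_add, Matrix.add_mul, Matrix.mul_assoc]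
  have hXdot : ∀ (f : Fin (n + 1) → ℂ) (j : Fin (n + 1)), f ⬝ᵥ star (X j) = conj (a j) *
      (conj (p j) * f j - ζ * shiftedRho α j * f ⟨j - 1, by omega⟩) := by
    intro f j
    have h1 : ∀ i, star (unitVec n i) = unitVec n i := by
      intro i; ext k; simp only [Pi.star_apply, unitVec]; split_ifs <;> simp
    rw [hXi]
    simp only [star_smul, star_sub, h1, dotProduct_smul, dotProduct_sub, smul_eq_mul,
      dotProduct_unitVec f j.2, dotProduct_unitVec f (show (j : ℕ) - 1 < n + 1 by omega),
      Complex.star_def, map_mul, Complex.conj_conj, Complex.conj_ofReal]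
  have hXii : ∀ i, X i i = a i * p i := by
    rintro ⟨i, hi⟩
    cases i <;> simp [X, unitVec, shiftedRho]
  have hX0 : ∀ i k : Fin (n + 1), i < k → X i k = 0 := by
    intro i k hik
    have h1 : (k : ℕ) ≠ i := by omega
    have h2 : (k : ℕ) ≠ (i : ℕ) - 1 := by omega
    simp [X, unitVec, h1, h2]
  have hB1 : ∀ i j : Fin (n + 1), j < i → (U * Xᴴ) i j = 0 := by
    intro i j hij
    have : (U * Xᴴ) i j = U i ⬝ᵥ star (X j) := rfl
    rw [this, hXdot]
    simp [U, hr0 i j hij, hr0 i ⟨j - 1, by omega⟩ (by simp; omega)]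
  have hB2 : ∀ i, (U * Xᴴ) i i = s * conj (beta n α τ ζ s c i) := by
    intro i
    have h1 : (U * Xᴴ) i i = U i ⬝ᵥ star (X i) := rfl
    have h2 := scaling_mul_pivot hα hτ hζ hs hreg hc (Nat.lt_succ_iff.1 i.2)
    have h3 : (shiftedRho α i : ℂ) * U i ⟨i - 1, by omega⟩ = 0 := by
      rcases i with ⟨i, hi⟩
      cases i with
      | zero => simp [shiftedRho]
      | succ i =>
        simp [U, hr0 ⟨i + 1, hi⟩ ⟨i, by omega⟩ (by simp)]
    have h4 : U i i = a i := by simp [U, hr1 i i rfl]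
    have h5 := congrArg conj h2
    simp only [map_mul, Complex.conj_conj, map_inv₀, hcs, inv_inv] at h5
    rw [h1, hXdot, h4, ← h5]
    linear_combination (-conj (a i) * ζ) * h3
  -- UX* is upper triangular, so its adjoint contributes nothing above the diagonal. There UX*
  -- agrees with the tridiagonal matrix XX*, hence is upper bidiagonal although U itself is a full
  -- triangular matrix.
  have hB3 : ∀ i j : Fin (n + 1), i < j → (U * Xᴴ) i j = (X * Xᴴ) i j := by
    intro i j hij
    rw [hXX, Matrix.add_apply, conjTranspose_apply, hB1 j i hij]; simp
  refine ⟨U, X, ?_, hUX, ?_, hXX⟩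
  · rw [isUnit_iff_isUnit_det, det_of_isLowerTriangular X (by intro i k hik; exact hX0 i k hik),
      isUnit_iff_ne_zero]
    exact Finset.prod_ne_zero_iff.2 fun i _ => by rw [hXii]; exact mul_ne_zero (ha i) (hp i)
  · ext i j
    rw [transpose_apply, matA, of_apply]
    rcases lt_trichotomy i j with hij | rfl | hij
    · have h1 : (X * Xᴴ) i j = X i ⬝ᵥ star (X j) := rfl
      rw [hB3 i j hij, h1, hXdot, if_neg hij.ne', hX0 i j hij]
      by_cases hj : (j : ℕ) = i + 1
      · have h2 : (⟨j - 1, by omega⟩ : Fin (n + 1)) = i := Fin.ext (by simp; omega)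
        have h4 : (rho α i : ℂ) ≠ 0 :=
          Complex.ofReal_ne_zero.2 (rho_pos (hα i (by omega))).ne'
        -- The definition of the scaling, tuned to make this superdiagonal entry equal to -s.
        have h5 : conj (a j) = s / (ζ * rho α i * p i * a i) := by
          rw [hj]; simp only [a, scaling, Complex.conj_conj]; rfl
        rw [if_pos hj, h2, hXii, h5, hj, shiftedRho]
        have := ha i
        have := hp i
        field_simp
        ring
      · have h2 : i < (⟨j - 1, by omega⟩ : Fin (n + 1)) := by rw [Fin.lt_def]; simp; omega
        rw [if_neg hj, hX0 _ _ h2]; simp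
    · rw [hB2, if_pos rfl]
    · rw [hB1 i j hij, if_neg hij.ne, if_neg (by omega)]; simp

end Congruence

end POPUC

namespace POPUC
open Matrix

/-! ### Cayley transform, Hermitian pencil and simplicity of its eigenvalues -/

section Cayley

variable {n : ℕ} {G : Matrix (Fin (n + 1)) (Fin (n + 1)) ℂ} {ζ s : ℂ} {β : ℕ → ℂ}

/-- The Cayley transform of a unitary matrix with respect to the point `ζ` of the unit circle. -/
noncomputable def cayley (ζ : ℂ) (G : Matrix (Fin (n + 1)) (Fin (n + 1)) ℂ) :
    Matrix (Fin (n + 1)) (Fin (n + 1)) ℂ :=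
  (-Complex.I) • ((2 : ℂ) • (1 - conj ζ • G)⁻¹ - 1)

/-- Multiply N N* = N + N* by the inverse of N on the left and that of N* on the right. -/
theorem inv_add_conjTranspose_inv (hG : G * Gᴴ = 1) (hζ : ‖ζ‖ = 1)
    (hN : IsUnit (1 - conj ζ • G)) :
    (1 - conj ζ • G)⁻¹ + ((1 - conj ζ • G)⁻¹)ᴴ = 1 := by
  have hz : ζ * conj ζ = 1 := by rw [Complex.mul_conj']; simp [hζ]
  have h1 : (1 - conj ζ • G) * (1 - conj ζ • G)ᴴ = (1 - conj ζ • G)ᴴ + (1 - conj ζ • G) := by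
    simp only [conjTranspose_sub, conjTranspose_one, conjTranspose_smul, Complex.star_def,
      Complex.conj_conj]
    rw [Matrix.sub_mul, Matrix.mul_sub, Matrix.mul_sub, smul_mul_smul_comm, hG, mul_comm, hz]
    simp only [Matrix.one_mul, Matrix.mul_one, one_smul]
    abel
  set N := 1 - conj ζ • G
  have hd : IsUnit N.det := (isUnit_iff_isUnit_det _).1 hN
  have hd' : IsUnit Nᴴ.det := by rw [det_conjTranspose]; exact hd.star
  rw [conjTranspose_nonsing_inv]
  calc N⁻¹ + Nᴴ⁻¹ = N⁻¹ * (Nᴴ + N) * Nᴴ⁻¹ := by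
        rw [Matrix.mul_add, Matrix.add_mul, Matrix.mul_assoc, mul_nonsing_inv _ hd',
          nonsing_inv_mul _ hd, Matrix.mul_one, Matrix.one_mul]
    _ = 1 := by
        rw [← h1, ← Matrix.mul_assoc, nonsing_inv_mul _ hd, Matrix.one_mul, mul_nonsing_inv _ hd']

theorem cayley_isHermitian (hG : G * Gᴴ = 1) (hζ : ‖ζ‖ = 1) (hN : IsUnit (1 - conj ζ • G)) :
    (cayley ζ G).IsHermitian := by
  have h := eq_sub_of_add_eq' (inv_add_conjTranspose_inv hG hζ hN)
  simp only [IsHermitian, cayley, conjTranspose_smul, conjTranspose_sub, conjTranspose_one, h,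
    Complex.star_def, map_neg, Complex.conj_I, map_ofNat]
  rw [smul_sub, smul_sub, smul_sub, smul_sub]
  module

theorem inv_eq_cayley : (1 - conj ζ • G)⁻¹ = (1 / 2 : ℂ) • (1 + Complex.I • cayley ζ G) := by
  rw [cayley, smul_smul]
  simp only [mul_neg, Complex.I_mul_I, neg_neg, one_smul]
  module

theorem one_add_I_mul_ne_zero (x : ℝ) : 1 + Complex.I * x ≠ 0 := by
  intro h; have := congrArg Complex.re h; simp at this

/-- Since G = ζ(1 - N) and N⁻¹ = (1 + iW)/2, a unitary diagonalization of W also diagonalizes G. -/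
theorem charpoly_eq_prod_of_cayley (hζ : ‖ζ‖ = 1) (hN : IsUnit (1 - conj ζ • G))
    {V : Matrix (Fin (n + 1)) (Fin (n + 1)) ℂ} {e : Fin (n + 1) → ℝ} (hV : V * star V = 1)
    (hV' : star V * V = 1) (hspec : cayley ζ G = V * diagonal (RCLike.ofReal ∘ e) * star V) :
    G.charpoly = ∏ i, (Polynomial.X - Polynomial.C
      (ζ * (1 - 2 / (1 + Complex.I * (e i : ℂ))))) := by
  have hz : ζ * conj ζ = 1 := by rw [Complex.mul_conj']; simp [hζ]
  have hM := inv_eq_cayley (ζ := ζ) (G := G)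
  have h1 : (1 - conj ζ • G)⁻¹ * (V * diagonal (fun i => 2 / (1 + Complex.I *
      (e i : ℂ))) * star V) = 1 := by
    have h2 : (1 - conj ζ • G)⁻¹ =
        V * diagonal (fun i => (1 + Complex.I * (e i : ℂ)) / 2) * star V := by
      have h3 : (diagonal (fun i => (1 + Complex.I * (e i : ℂ)) / 2) :
          Matrix (Fin (n + 1)) (Fin (n + 1)) ℂ) =
          (1 / 2 : ℂ) • (1 + Complex.I • diagonal (RCLike.ofReal ∘ e)) := by
        rw [← diagonal_one, ← diagonal_smul, diagonal_add, ← diagonal_smul]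
        congr 1; ext i; simp; ring
      rw [hM, h3, hspec]
      simp only [Matrix.mul_smul, Matrix.smul_mul, Matrix.mul_add, Matrix.add_mul, Matrix.mul_one,
        hV]
    rw [h2]
    calc _ = V * diagonal (fun i => (1 + Complex.I * (e i : ℂ)) / 2) * (star V * V) *
          diagonal (fun i => 2 / (1 + Complex.I * (e i : ℂ))) * star V := by
          simp only [Matrix.mul_assoc]
      _ = V * (diagonal (fun i => (1 + Complex.I * (e i : ℂ)) / 2) *
          diagonal (fun i => 2 / (1 + Complex.I * (e i : ℂ)))) * star V := by
          rw [hV', Matrix.mul_one]; simp only [Matrix.mul_assoc]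
      _ = 1 := by
          rw [diagonal_mul_diagonal]
          have : (fun i => (1 + Complex.I * (e i : ℂ)) / 2 *
              (2 / (1 + Complex.I * (e i : ℂ)))) = fun _ => 1 := by
            ext i
            have := one_add_I_mul_ne_zero (e i)
            field_simp
          rw [this, diagonal_one, Matrix.mul_one, hV]
  have hd : IsUnit (1 - conj ζ • G).det := (isUnit_iff_isUnit_det _).1 hN
  have h4 : 1 - conj ζ • G = V * diagonal (fun i => 2 / (1 + Complex.I *
      (e i : ℂ))) * star V := by
    have := congrArg (fun Y => (1 - conj ζ • G) * Y) h1
    simp only [← Matrix.mul_assoc, mul_nonsing_inv _ hd, Matrix.one_mul, Matrix.mul_one] at this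
    rw [← this]
  have h5 : G = V * diagonal (fun i => ζ * (1 - 2 / (1 + Complex.I *
      (e i : ℂ)))) * star V := by
    have h6 : G = ζ • (1 - (1 - conj ζ • G)) := by
      rw [sub_sub_cancel, smul_smul, hz, one_smul]
    have h7 : (diagonal (fun i => ζ * (1 - 2 / (1 + Complex.I * (e i : ℂ)))) :
        Matrix (Fin (n + 1)) (Fin (n + 1)) ℂ) =
        ζ • (1 - diagonal (fun i => 2 / (1 + Complex.I * (e i : ℂ)))) := by
      rw [← diagonal_one, diagonal_sub, ← diagonal_smul]; rfl
    rw [h7]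
    refine h6.trans ?_
    rw [h4]
    simp only [Matrix.mul_smul, Matrix.smul_mul, Matrix.mul_sub, Matrix.sub_mul, Matrix.mul_one, hV]
  rw [h5, charpoly_mul_comm, ← Matrix.mul_assoc, hV', Matrix.one_mul, charpoly_diagonal]

/-- For i = n the vector `unitVec n (n + 1)` is zero, so the last row needs no separate case. -/
theorem transpose_matA_mulVec (n : ℕ) (s : ℂ) (β : ℕ → ℂ) (w : Fin (n + 1) → ℂ) (i : Fin (n + 1)) :
    ((matA n s β)ᵀ *ᵥ w) i =
      s * conj (β i) * w i - s * (w ⬝ᵥ unitVec n (i + 1)) := by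
  have h1 : (matA n s β)ᵀ i = (s * conj (β i)) • unitVec n i - s • unitVec n (i + 1) := by
    ext k
    simp only [transpose_apply, matA, of_apply, unitVec, Pi.sub_apply, Pi.smul_apply, smul_eq_mul,
      Fin.ext_iff]
    split_ifs with h1 h2 h3 <;> first | omega | simp
    exact Or.inl (by rw [h1])
  rw [mulVec, h1, sub_dotProduct, smul_dotProduct, smul_dotProduct, dotProduct_comm,
    dotProduct_comm _ w, dotProduct_unitVec w i.2]
  rfl

theorem transpose_matA_conjTranspose_mulVec (n : ℕ) (s : ℂ) (β : ℕ → ℂ) (w : Fin (n + 1) → ℂ)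
    (i : Fin (n + 1)) :
    ((matA n s β)ᵀᴴ *ᵥ w) i = conj s * β i * w i -
      conj s * (if h : (i : ℕ) = 0 then 0 else w ⟨i - 1, by omega⟩) := by
  have h1 : (matA n s β)ᵀᴴ i = (conj s * β i) • unitVec n i -
      conj s • (if (i : ℕ) = 0 then 0 else unitVec n (i - 1)) := by
    ext k
    by_cases h0 : (i : ℕ) = 0
    · simp only [conjTranspose_apply, transpose_apply, matA, of_apply, unitVec, Pi.sub_apply,
        Pi.smul_apply, smul_eq_mul, Fin.ext_iff, if_pos h0, Pi.zero_apply, Complex.star_def]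
      split_ifs with h1 h2 h3 <;> first | omega | simp
    · simp only [conjTranspose_apply, transpose_apply, matA, of_apply, unitVec, Pi.sub_apply,
        Pi.smul_apply, smul_eq_mul, Fin.ext_iff, if_neg h0, Complex.star_def]
      split_ifs with h1 h2 h3 <;> first | omega | simp
  rw [mulVec, h1, sub_dotProduct, smul_dotProduct, smul_dotProduct, dotProduct_comm,
    dotProduct_comm _ w, dotProduct_unitVec w i.2]
  split_ifs with h
  · simp
  · rw [dotProduct_unitVec w (show (i : ℕ) - 1 < n + 1 by omega)]; rfl

/-- The solution `0, w_0, w_1, …` of the three-term recurrence for kernel vectors of the pencil. -/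
noncomputable def kerVec (s : ℂ) (β : ℕ → ℂ) (μ : ℝ) : ℕ → ℂ
  | 0 => 0
  | 1 => 1
  | k + 2 => s⁻¹ * (s * conj (β k) * kerVec s β μ (k + 1) + (μ - Complex.I) / (μ + Complex.I) *
      (conj s * β k * kerVec s β μ (k + 1) - conj s * kerVec s β μ k))

/-- The equation `K w = μ H w` for `Aᵀ = H + i K`. -/
def IsPencilKernel (s : ℂ) (β : ℕ → ℂ) (μ : ℝ) (w : Fin (n + 1) → ℂ) : Prop :=
  (μ + Complex.I) • ((matA n s β)ᵀ *ᵥ w) + (μ - Complex.I) • ((matA n s β)ᵀᴴ *ᵥ w) = 0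

theorem ofReal_add_I_ne_zero (x : ℝ) : (x : ℂ) + Complex.I ≠ 0 := by
  intro h; have := congrArg Complex.im h; simp at this

/-- Row k of the pencil equation determines w_{k+1} from w_k and w_{k-1}, because its coefficient
-s(μ + i) is nonzero for real μ. The last row is not needed. Thus each kernel is at most
one-dimensional. -/
theorem IsPencilKernel.eq_kerVec (hs : s ≠ 0) {μ : ℝ} {w : Fin (n + 1) → ℂ}
    (hw : IsPencilKernel s β μ w) (i : Fin (n + 1)) : w i = w 0 * kerVec s β μ (i + 1) := by
  have key : ∀ k, ∀ hk : k < n + 1, w ⟨k, hk⟩ = w 0 * kerVec s β μ (k + 1) := by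
    intro k
    induction k using Nat.strong_induction_on with
    | _ k ih =>
      intro hk
      cases k with
      | zero => simp [kerVec]
      | succ k =>
        have h1 := congrFun hw ⟨k, by omega⟩
        have h0 := ih k (by omega) (by omega)
        have hI := ofReal_add_I_ne_zero μ
        simp only [Pi.add_apply, Pi.smul_apply, smul_eq_mul, transpose_matA_mulVec,
          transpose_matA_conjTranspose_mulVec, Pi.zero_apply, dotProduct_unitVec w hk] at h1
        have h2 : (if h : k = 0 then 0 else w ⟨k - 1, by omega⟩) = w 0 * kerVec s β μ k := by
          split_ifs with h
          · simp [h, kerVec]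
          · obtain ⟨l, rfl⟩ : ∃ l, k = l + 1 := ⟨k - 1, by omega⟩
            exact ih l (by omega) (by omega)
        rw [h2, h0] at h1
        rw [kerVec]
        field_simp
        linear_combination -h1
  exact key i i.2

/-- From Aᵀ = X N⁻¹ X*, the vectors Aᵀw and (Aᵀ)*w are (1 ± iμ)/2 times the same vector XX*w, and
the pencil combination of these two scalars vanishes. -/
theorem isPencilKernel_of_eigenvector {U X : Matrix (Fin (n + 1)) (Fin (n + 1)) ℂ}
    (hN : IsUnit (1 - conj ζ • G)) (hU : U * (1 - conj ζ • G) = X)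
    (hB : U * Xᴴ = (matA n s β)ᵀ) (hXX : X * Xᴴ = U * Xᴴ + (U * Xᴴ)ᴴ) {μ : ℝ}
    {w : Fin (n + 1) → ℂ} (hy : cayley ζ G *ᵥ (Xᴴ *ᵥ w) = (μ : ℂ) • (Xᴴ *ᵥ w)) :
    IsPencilKernel s β μ w := by
  have hd : IsUnit (1 - conj ζ • G).det := (isUnit_iff_isUnit_det _).1 hN
  have hU' : U = X * (1 - conj ζ • G)⁻¹ := by
    rw [← hU, Matrix.mul_assoc, mul_nonsing_inv _ hd, Matrix.mul_one]
  have h1 : (1 - conj ζ • G)⁻¹ *ᵥ (Xᴴ *ᵥ w) = ((1 + Complex.I * μ) / 2) • (Xᴴ *ᵥ w) := by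
    rw [inv_eq_cayley, smul_mulVec, add_mulVec, one_mulVec, smul_mulVec, hy]
    module
  have h2 : (matA n s β)ᵀ *ᵥ w = ((1 + Complex.I * μ) / 2) • (X *ᵥ (Xᴴ *ᵥ w)) := by
    rw [← hB, hU', ← mulVec_mulVec, ← mulVec_mulVec, h1, mulVec_smul]
  have h3 : (matA n s β)ᵀᴴ *ᵥ w = ((1 - Complex.I * μ) / 2) • (X *ᵥ (Xᴴ *ᵥ w)) := by
    rw [hB] at hXX
    rw [← sub_eq_iff_eq_add'.2 hXX, sub_mulVec, h2, ← mulVec_mulVec]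
    module
  rw [IsPencilKernel, h2, h3, smul_smul, smul_smul, ← add_smul]
  have : (μ + Complex.I) * ((1 + Complex.I * μ) / 2) + (μ - Complex.I) * ((1 - Complex.I * μ) / 2)
      = 0 := by
    linear_combination (μ : ℂ) * Complex.I_sq
  rw [this, zero_smul]

theorem isUnit_of_notMem_spectrum (hζ : ‖ζ‖ = 1) (hreg : ζ ∉ spectrum ℂ G) :
    IsUnit (1 - conj ζ • G) := by
  have hz : ζ * conj ζ = 1 := by rw [Complex.mul_conj']; simp [hζ]
  rw [spectrum.notMem_iff] at hreg
  have : algebraMap ℂ (Matrix (Fin (n + 1)) (Fin (n + 1)) ℂ) ζ - G = ζ • (1 - conj ζ • G) := by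
    rw [smul_sub, smul_smul, hz, one_smul, Algebra.algebraMap_eq_smul_one]
  rw [this, isUnit_iff_isUnit_det, det_smul] at hreg
  exact (isUnit_iff_isUnit_det _).2 (isUnit_of_mul_isUnit_right hreg)

/-- The Cayley transform has simple eigenvalues `μ_k`, and the pencil has explicit kernel vectors
at these values. -/
theorem exists_spectral_data {U X : Matrix (Fin (n + 1)) (Fin (n + 1)) ℂ} (hG : G * Gᴴ = 1)
    (hζ : ‖ζ‖ = 1) (hs : s ≠ 0) (hN : IsUnit (1 - conj ζ • G)) (hX : IsUnit X)
    (hU : U * (1 - conj ζ • G) = X) (hB : U * Xᴴ = (matA n s β)ᵀ)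
    (hXX : X * Xᴴ = U * Xᴴ + (U * Xᴴ)ᴴ) :
    ∃ μ : Fin (n + 1) → ℝ, StrictMono μ ∧
      (∀ k, IsPencilKernel s β (μ k) fun i : Fin (n + 1) => kerVec s β (μ k) (i + 1)) ∧
      (∀ x : ℂ, (x • 1 - cayley ζ G).det = ∏ k, (x - μ k)) ∧
      G.charpoly = ∏ k, (Polynomial.X - Polynomial.C (ζ * (1 - 2 / (1 + Complex.I * μ k)))) := by
  have hW := cayley_isHermitian hG hζ hN
  have hXd : IsUnit Xᴴ.det := by
    rw [det_conjTranspose]; exact ((isUnit_iff_isUnit_det _).1 hX).star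
  let σ := Tuple.sort hW.eigenvalues
  let w : Fin (n + 1) → Fin (n + 1) → ℂ := fun i => Xᴴ⁻¹ *ᵥ (hW.eigenvectorBasis i).ofLp
  have hXw : ∀ i, Xᴴ *ᵥ w i = (hW.eigenvectorBasis i).ofLp := fun i => by
    simp only [w]; rw [mulVec_mulVec, mul_nonsing_inv _ hXd, one_mulVec]
  have hker : ∀ i, IsPencilKernel s β (hW.eigenvalues i) (w i) := fun i => by
    refine isPencilKernel_of_eigenvector hN hU hB hXX ?_
    rw [hXw, hW.mulVec_eigenvectorBasis]
    ext k; simp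
  have hrec : ∀ i, w i = w i 0 • fun k : Fin (n + 1) => kerVec s β (hW.eigenvalues i) (k + 1) :=
    fun i => funext fun k => (hker i).eq_kerVec hs k
  have hw0 : ∀ i, w i 0 ≠ 0 := by
    intro i h0
    have h1 : w i = 0 := by rw [hrec i, h0, zero_smul]
    have h2 := hXw i
    rw [h1, mulVec_zero] at h2
    have h3 := hW.eigenvectorBasis.orthonormal.1 i
    have h4 : hW.eigenvectorBasis i = 0 := by ext k; rw [← h2]; rfl
    rw [h4, norm_zero] at h3
    exact zero_ne_one h3
  -- Two members of the orthonormal eigenbasis with equal eigenvalues would come from multiples of a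
  -- single recurrence solution, contradicting orthogonality.
  have hinj : Function.Injective hW.eigenvalues := by
    intro i j hij
    by_contra hne
    have h1 : w j 0 • w i = w i 0 • w j := by
      have hi := hrec i
      rw [hij] at hi
      rw [hi, hrec j]
      simp only [Pi.smul_apply, kerVec, smul_eq_mul, mul_one, smul_smul, Fin.val_zero, zero_add]
      rw [mul_comm]
    have h2 : w j 0 • hW.eigenvectorBasis i = w i 0 • hW.eigenvectorBasis j := by
      have := congrArg (fun v => Xᴴ *ᵥ v) h1
      simp only [mulVec_smul, hXw] at this
      ext k; exact congrFun this k
    have h3 := congrArg (fun v => inner ℂ (hW.eigenvectorBasis j) v) h2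
    simp only [inner_smul_right, OrthonormalBasis.inner_eq_ite, if_neg (Ne.symm hne),
      if_pos, mul_zero, mul_one] at h3
    exact hw0 i h3.symm
  refine ⟨hW.eigenvalues ∘ σ, (Tuple.monotone_sort _).strictMono_of_injective
    (hinj.comp σ.injective), ?_, ?_, ?_⟩
  · intro k
    have h1 := hker (σ k)
    rw [hrec (σ k), IsPencilKernel, mulVec_smul, mulVec_smul, smul_comm, smul_comm (_ - _),
      ← smul_add, smul_eq_zero] at h1
    exact h1.resolve_left (hw0 _)
  · intro x
    have h1 := congrArg (Polynomial.eval x) hW.charpoly_eq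
    rw [eval_charpoly, Polynomial.eval_prod] at h1
    simp only [Polynomial.eval_sub, Polynomial.eval_X, Polynomial.eval_C] at h1
    rw [scalar_apply, ← smul_one_eq_diagonal] at h1
    rw [h1]
    exact (Equiv.prod_comp σ fun i => x - ((hW.eigenvalues i : ℝ) : ℂ)).symm
  · have hspec := hW.spectral_theorem
    rw [Unitary.conjStarAlgAut_apply] at hspec
    rw [charpoly_eq_prod_of_cayley hζ hN (Unitary.coe_mul_star_self _)
      (Unitary.coe_star_mul_self _) hspec]
    exact (Equiv.prod_comp σ fun i => Polynomial.X - Polynomial.C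
      (ζ * (1 - 2 / (1 + Complex.I * (hW.eigenvalues i : ℂ))))).symm

end Cayley

end POPUC

/-! ### Continuity of ordered simple roots -/

namespace POPUC
open Matrix Filter Topology

/-- The sorted roots of a continuous family of real-rooted polynomials with simple roots are
continuous. -/
theorem continuousWithinAt_sorted_roots {m : ℕ} {J : Set ℝ} {t₀ : ℝ} (ht₀ : t₀ ∈ J)
    {μ : ℝ → Fin m → ℝ} (hμ : ∀ t ∈ J, StrictMono (μ t)) {P : ℝ → ℂ → ℂ}
    (hP : ∀ t ∈ J, ∀ x, P t x = ∏ k, (x - μ t k))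
    (hc : ∀ x, ContinuousWithinAt (fun t => P t x) J t₀) (k : Fin m) :
    ContinuousWithinAt (fun t => μ t k) J t₀ := by
  rw [Metric.continuousWithinAt_iff']
  intro ε hε
  -- With δ below half of every gap, the δ-neighbourhoods of the roots at t₀ are disjoint and
  -- ordered.
  obtain ⟨δ, hδ0, hδε, hδ⟩ : ∃ δ > 0, δ < ε ∧ ∀ i j, i < j → 2 * δ < μ t₀ j - μ t₀ i := by
    have h1 : ∀ᶠ δ in 𝓝[>] (0 : ℝ), ∀ i j, i < j → 2 * δ < μ t₀ j - μ t₀ i := by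
      refine eventually_all.2 fun i => eventually_all.2 fun j => ?_
      by_cases hij : i < j
      · have h2 : 0 < μ t₀ j - μ t₀ i := sub_pos.2 (hμ t₀ ht₀ hij)
        have h3 : ∀ᶠ δ in 𝓝[>] (0 : ℝ), δ < (μ t₀ j - μ t₀ i) / 2 :=
          nhdsWithin_le_nhds (eventually_lt_nhds (by positivity))
        filter_upwards [h3] with δ hδ _
        linarith
      · simp [hij]
    have h4 : ∀ᶠ δ in 𝓝[>] (0 : ℝ), δ < ε := nhdsWithin_le_nhds (eventually_lt_nhds hε)
    obtain ⟨δ, h5, h6, h7⟩ := (h1.and (h4.and self_mem_nhdsWithin)).exists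
    exact ⟨δ, h7, h6, h5⟩
  have hsmall : ∀ᶠ t in 𝓝[J] t₀, ∀ i, ‖P t (μ t₀ i)‖ < δ ^ m := by
    refine eventually_all.2 fun i => ?_
    have h0 : ‖P t₀ (μ t₀ i)‖ = 0 := by
      rw [norm_eq_zero, hP t₀ ht₀]
      exact Finset.prod_eq_zero (Finset.mem_univ i) (sub_self _)
    have h1 := (hc (μ t₀ i)).norm
    exact h1.eventually (eventually_lt_nhds (by simp only [h0]; positivity))
  filter_upwards [hsmall, self_mem_nhdsWithin] with t ht htJ
  -- If all m roots at t were at distance at least δ from the i-th root at t₀, the product would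
  -- have modulus at least δ^m.
  have hex : ∀ i, ∃ j, |μ t₀ i - μ t j| < δ := by
    intro i
    by_contra! hcon
    have h1 := ht i
    rw [hP t htJ, norm_prod] at h1
    refine h1.not_ge ?_
    calc δ ^ m = ∏ _j : Fin m, δ := by simp
      _ ≤ _ := by
        refine Finset.prod_le_prod (fun _ _ => hδ0.le) fun j _ => ?_
        rw [← Complex.ofReal_sub, Complex.norm_real]
        exact hcon j
  choose σ hσ using hex
  have hσm : StrictMono σ := by
    intro i j hij
    rw [← (hμ t htJ).lt_iff_lt]
    have h1 := abs_lt.1 (hσ i)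
    have h2 := abs_lt.1 (hσ j)
    have h3 := hδ i j hij
    linarith
  -- A strictly increasing self-map of a finite chain is the identity, so the nearby roots carry
  -- matching indices.
  have hσid : σ = id := (StrictMono.range_inj hσm strictMono_id).1 (by
    rw [Set.range_id, (Finite.injective_iff_surjective.1 hσm.injective).range_eq])
  have := hσ k
  rw [hσid, id, abs_sub_comm] at this
  exact this.trans hδε

/-! ### Perturbation and sign of pencil eigenvalues -/

section Pencil

variable {n : ℕ} {s : ℂ}

theorem isPencilKernel_iff {β : ℕ → ℂ} {μ : ℝ} {w : Fin (n + 1) → ℂ} :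
    IsPencilKernel s β μ w ↔
      ((2 : ℂ) • matK n s β)ᵀ *ᵥ w = (μ : ℂ) • (((matA n s β)ᵀ + (matA n s β)ᵀᴴ) *ᵥ w) := by
  have h1 : ((2 : ℂ) • matK n s β)ᵀ = (-Complex.I) • ((matA n s β)ᵀ - (matA n s β)ᵀᴴ) := by
    have : (2 : ℂ) * (1 / (2 * Complex.I)) = -Complex.I := by
      field_simp; rw [Complex.I_sq]; ring
    rw [matK, smul_smul, this]
    rfl
  rw [IsPencilKernel, h1, smul_mulVec, sub_mulVec, add_mulVec]
  set a := (matA n s β)ᵀ *ᵥ w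
  set b := (matA n s β)ᵀᴴ *ᵥ w
  rw [← sub_eq_zero (b := (μ : ℂ) • (a + b)), ← neg_eq_zero]
  have : -(((μ : ℂ) + Complex.I) • a + ((μ : ℂ) - Complex.I) • b) =
      -Complex.I • (a - b) - (μ : ℂ) • (a + b) := by module
  rw [this]

/-- The off-diagonal entries do not involve β and cancel in the difference. -/
theorem transpose_matA_add_conjTranspose_sub (hs : ‖s‖ = 1) (β β' : ℕ → ℂ) :
    ((matA n s β')ᵀ + (matA n s β')ᵀᴴ) - ((matA n s β)ᵀ + (matA n s β)ᵀᴴ) =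
      diagonal fun i : Fin (n + 1) => ((2 * ((s⁻¹ * β' i).re - (s⁻¹ * β i).re) : ℝ) : ℂ) := by
  have hss : s * conj s = 1 := by rw [Complex.mul_conj']; simp [hs]
  have hcs : conj s = s⁻¹ := eq_inv_of_mul_eq_one_right hss
  have hr : ∀ z : ℂ, ((2 * (s⁻¹ * z).re : ℝ) : ℂ) = s * conj z + conj s * z := by
    intro z
    rw [← hcs, ← Complex.add_conj, map_mul, Complex.conj_conj]; ring
  ext i k
  simp only [Matrix.sub_apply, Matrix.add_apply, transpose_apply, conjTranspose_apply, matA, of_apply,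
    diagonal_apply, Complex.star_def, map_mul]
  by_cases hik : i = k
  · subst hik
    simp only [if_true, Complex.conj_conj]
    rw [mul_sub, Complex.ofReal_sub, hr, hr]
  · simp [hik, Ne.symm hik]

/-- The minus sign arises because A carries s conj β_j = conj(s⁻¹ β_j) on its diagonal. -/
theorem two_matK_transpose_sub (hs : ‖s‖ = 1) (β β' : ℕ → ℂ) :
    ((2 : ℂ) • matK n s β')ᵀ - ((2 : ℂ) • matK n s β)ᵀ =
      diagonal fun i : Fin (n + 1) => ((-2 * ((s⁻¹ * β' i).im - (s⁻¹ * β i).im) : ℝ) : ℂ) := by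
  have hss : s * conj s = 1 := by rw [Complex.mul_conj']; simp [hs]
  have hcs : conj s = s⁻¹ := eq_inv_of_mul_eq_one_right hss
  have hr : ∀ z : ℂ, ((2 * (s⁻¹ * z).im : ℝ) : ℂ) * Complex.I = conj s * z - s * conj z := by
    intro z
    rw [← hcs, ← Complex.sub_conj, map_mul, Complex.conj_conj]
  have h2 : (2 : ℂ) * (1 / (2 * Complex.I)) = -Complex.I := by
    field_simp; rw [Complex.I_sq]; ring
  ext i k
  simp only [matK, smul_smul, h2, Matrix.sub_apply, Matrix.smul_apply, transpose_apply, conjTranspose_apply, matA,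
    of_apply, diagonal_apply, Complex.star_def, map_mul, smul_eq_mul]
  by_cases hik : i = k
  · subst hik
    simp only [if_true, Complex.conj_conj]
    have e1 := hr (β' i)
    have e2 := hr (β i)
    push_cast at e1 e2 ⊢
    linear_combination -Complex.I * e1 + Complex.I * e2 +
      (2 * (((s⁻¹ * β' i).im : ℂ) - ((s⁻¹ * β i).im : ℂ))) * Complex.I_sq
  · simp [hik, Ne.symm hik]

theorem matK_isHermitian (β : ℕ → ℂ) : (matK n s β).IsHermitian := by
  rw [IsHermitian, matK, conjTranspose_smul, conjTranspose_sub, conjTranspose_conjTranspose]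
  have : star (1 / (2 * Complex.I)) = -(1 / (2 * Complex.I)) := by
    simp
  rw [this, neg_smul, ← smul_neg, neg_sub]

/-- The difference formula for eigenvalues of the pencil. -/
theorem pencil_difference (hs : ‖s‖ = 1) {β β' : ℕ → ℂ} {μ μ' : ℝ} {v w : Fin (n + 1) → ℂ}
    (hv : IsPencilKernel s β μ v) (hw : IsPencilKernel s β' μ' w) :
    ((μ' - μ : ℝ) : ℂ) * (star v ⬝ᵥ ((matA n s β)ᵀ + (matA n s β)ᵀᴴ) *ᵥ w) =
      ∑ i : Fin (n + 1), conj (v i) * w i * ((-2 * ((s⁻¹ * β' i).im - (s⁻¹ * β i).im +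
        μ' * ((s⁻¹ * β' i).re - (s⁻¹ * β i).re)) : ℝ) : ℂ) := by
  rw [isPencilKernel_iff] at hv hw
  have hH := transpose_matA_add_conjTranspose_sub (n := n) hs β β'
  have hK := two_matK_transpose_sub (n := n) hs β β'
  have hHh : ((matA n s β)ᵀ + (matA n s β)ᵀᴴ).IsHermitian := by
    rw [IsHermitian, conjTranspose_add, conjTranspose_conjTranspose]
    exact add_comm _ _
  have hKh : (((2 : ℂ) • matK n s β)ᵀ).IsHermitian := by
    have := (matK_isHermitian (n := n) (s := s) β).transpose
    rw [transpose_smul, IsHermitian, conjTranspose_smul, this.eq]; simp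
  set H := (matA n s β)ᵀ + (matA n s β)ᵀᴴ
  set H' := (matA n s β')ᵀ + (matA n s β')ᵀᴴ
  set K := ((2 : ℂ) • matK n s β)ᵀ
  set K' := ((2 : ℂ) • matK n s β')ᵀ
  have h1 : star v ⬝ᵥ K *ᵥ w = μ * (star v ⬝ᵥ H *ᵥ w) := by
    have h2 := congrArg star hv
    rw [star_mulVec, star_smul, star_mulVec, hKh.eq, hHh.eq] at h2
    rw [dotProduct_mulVec, h2, smul_dotProduct, ← dotProduct_mulVec]
    simp
  -- Pair the equation K'w = μ'H'w with v on the left, and use that K and H are Hermitian to move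
  -- the equation for v across.
  have h3 : star v ⬝ᵥ (K' - K) *ᵥ w - μ' * (star v ⬝ᵥ (H' - H) *ᵥ w) =
      ((μ' - μ : ℝ) : ℂ) * (star v ⬝ᵥ H *ᵥ w) := by
    rw [sub_mulVec, sub_mulVec, hw, dotProduct_sub, dotProduct_sub, dotProduct_smul, h1]
    push_cast; rw [smul_eq_mul]; ring
  rw [← h3, hH, hK, dotProduct, dotProduct, Finset.mul_sum, ← Finset.sum_sub_distrib]
  refine Finset.sum_congr rfl fun i _ => ?_
  simp only [mulVec_diagonal, Pi.star_apply, Complex.star_def]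
  push_cast; ring

theorem continuousWithinAt_kerVec {J : Set ℝ} {t₀ : ℝ} {β : ℝ → ℕ → ℂ} {μ : ℝ → ℝ}
    (hβ : ∀ j ≤ n, ContinuousWithinAt (fun t => β t j) J t₀) (hμ : ContinuousWithinAt μ J t₀)
    {k : ℕ} (hk : k ≤ n + 1) :
    ContinuousWithinAt (fun t => kerVec s (β t) (μ t) k) J t₀ := by
  have hμ' : ContinuousWithinAt (fun t => (μ t : ℂ)) J t₀ :=
    Complex.continuous_ofReal.continuousAt.comp_continuousWithinAt hμ
  induction k using Nat.strong_induction_on with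
  | _ k ih =>
    match k with
    | 0 => exact continuousWithinAt_const
    | 1 => exact continuousWithinAt_const
    | k + 2 =>
      have h1 := ih (k + 1) (by omega) (by omega)
      have h0 := ih k (by omega) (by omega)
      have hb := hβ k (by omega)
      have hb' : ContinuousWithinAt (fun t => conj (β t k)) J t₀ :=
        Complex.continuous_conj.continuousAt.comp_continuousWithinAt hb
      simp only [kerVec]
      exact continuousWithinAt_const.mul (((continuousWithinAt_const.mul hb').mul h1).add
        (((hμ'.sub continuousWithinAt_const).div (hμ'.add continuousWithinAt_const)
          (ofReal_add_I_ne_zero _)).mul (((continuousWithinAt_const.mul hb).mul h1).sub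
            (continuousWithinAt_const.mul h0))))

/-- The derivative of an eigenvalue of the pencil. -/
theorem hasDerivWithinAt_pencil (hs : ‖s‖ = 1) {J : Set ℝ} {t₀ : ℝ} (ht₀ : t₀ ∈ J)
    {β : ℝ → ℕ → ℂ} {μ : ℝ → ℝ} {x y : ℕ → ℝ}
    (hx : ∀ j ≤ n, HasDerivAt (fun u => (s⁻¹ * β u j).re) (x j) t₀)
    (hy : ∀ j ≤ n, HasDerivAt (fun u => (s⁻¹ * β u j).im) (y j) t₀)
    (hμ : ContinuousWithinAt μ J t₀)
    (hker : ∀ t ∈ J, IsPencilKernel s (β t) (μ t)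
      fun i : Fin (n + 1) => kerVec s (β t) (μ t) (i + 1))
    (hH : ((matA n s (β t₀))ᵀ + (matA n s (β t₀))ᵀᴴ).PosDef) :
    ∃ q > 0, HasDerivWithinAt μ (-(q * ∑ i : Fin (n + 1),
      Complex.normSq (kerVec s (β t₀) (μ t₀) (i + 1)) * (y i + μ t₀ * x i))) J t₀ := by
  have hs0 : s ≠ 0 := by rintro rfl; simp at hs
  have hβ : ∀ j ≤ n, ContinuousWithinAt (fun t => β t j) J t₀ := by
    intro j hj
    have h1 : (fun t => β t j) =
        fun t => s * (((s⁻¹ * β t j).re : ℂ) + ((s⁻¹ * β t j).im : ℂ) * Complex.I) := by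
      ext t; rw [Complex.re_add_im, mul_inv_cancel_left₀ hs0]
    rw [h1]
    have h2 := (Complex.continuous_ofReal.continuousAt.comp (hx j hj).continuousAt)
    have h3 := (Complex.continuous_ofReal.continuousAt.comp (hy j hj).continuousAt)
    exact (continuousAt_const.mul (h2.add (h3.mul continuousAt_const))).continuousWithinAt
  set v : Fin (n + 1) → ℂ := fun i => kerVec s (β t₀) (μ t₀) (i + 1) with hv
  set H := (matA n s (β t₀))ᵀ + (matA n s (β t₀))ᵀᴴ
  let w : ℝ → Fin (n + 1) → ℂ := fun t i => kerVec s (β t) (μ t) (i + 1)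
  have hw : ContinuousWithinAt w J t₀ := continuousWithinAt_pi.2 fun i =>
    continuousWithinAt_kerVec hβ hμ (by omega)
  let Q : ℝ → ℂ := fun t => star v ⬝ᵥ H *ᵥ w t
  have hQc : ContinuousWithinAt Q J t₀ := by
    have : Continuous fun w : Fin (n + 1) → ℂ => star v ⬝ᵥ H *ᵥ w := by fun_prop
    exact this.continuousAt.comp_continuousWithinAt hw
  have hv0 : v ≠ 0 := by
    intro h; have := congrFun h 0; simp [hv, kerVec] at this
  have hQ0 : 0 < Q t₀ := hH.dotProduct_mulVec_pos hv0
  obtain ⟨q, hq⟩ : ∃ q : ℝ, (q : ℂ) = Q t₀ := ⟨(Q t₀).re,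
    Complex.ext rfl (Complex.pos_iff.1 hQ0).2⟩
  have hq0 : 0 < q := by rw [← hq] at hQ0; exact_mod_cast hQ0
  refine ⟨2 * q⁻¹, by positivity, ?_⟩
  rw [hasDerivWithinAt_iff_tendsto_slope]
  have hsub : 𝓝[J \ {t₀}] t₀ ≤ 𝓝[J] t₀ := nhdsWithin_mono _ Set.sdiff_subset
  have hlim : Tendsto (fun t => (Q t)⁻¹ * ∑ i : Fin (n + 1), conj (v i) * w t i *
      ((-2 * (slope (fun u => (s⁻¹ * β u i).im) t₀ t +
        μ t * slope (fun u => (s⁻¹ * β u i).re) t₀ t) : ℝ) : ℂ)) (𝓝[J \ {t₀}] t₀)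
      (𝓝 ((Q t₀)⁻¹ * ∑ i : Fin (n + 1), conj (v i) * w t₀ i *
        ((-2 * (y i + μ t₀ * x i) : ℝ) : ℂ))) := by
    refine Tendsto.mul ((hQc.mono_left hsub).inv₀ hQ0.ne') (tendsto_finsetSum _ fun i _ => ?_)
    have hwi : Tendsto (fun t => w t i) (𝓝[J \ {t₀}] t₀) (𝓝 (w t₀ i)) :=
      (continuousWithinAt_pi.1 hw i).mono_left hsub
    have hxi := hasDerivWithinAt_iff_tendsto_slope.1
      ((hx i (Nat.lt_succ_iff.1 i.2)).hasDerivWithinAt (s := J))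
    have hyi := hasDerivWithinAt_iff_tendsto_slope.1
      ((hy i (Nat.lt_succ_iff.1 i.2)).hasDerivWithinAt (s := J))
    exact (tendsto_const_nhds.mul hwi).mul ((Complex.continuous_ofReal.tendsto _).comp
      (tendsto_const_nhds.mul (hyi.add ((hμ.mono_left hsub).mul hxi))))
  have hre := (Complex.continuous_re.tendsto _).comp hlim
  have hval : ((Q t₀)⁻¹ * ∑ i : Fin (n + 1), conj (v i) * w t₀ i *
      ((-2 * (y i + μ t₀ * x i) : ℝ) : ℂ)).re =
      -(2 * q⁻¹ * ∑ i : Fin (n + 1), Complex.normSq (v i) * (y i + μ t₀ * x i)) := by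
    rw [← hq]
    have : ∑ i : Fin (n + 1), conj (v i) * w t₀ i * ((-2 * (y i + μ t₀ * x i) : ℝ) : ℂ) =
        ((-2 * ∑ i : Fin (n + 1), Complex.normSq (v i) * (y i + μ t₀ * x i) : ℝ) : ℂ) := by
      rw [Finset.mul_sum, Complex.ofReal_sum]
      refine Finset.sum_congr rfl fun i _ => ?_
      have : conj (v i) * w t₀ i = (Complex.normSq (v i) : ℂ) := by
        rw [Complex.normSq_eq_conj_mul_self]
      rw [this]; push_cast; ring
    rw [this, ← Complex.ofReal_inv, ← Complex.ofReal_mul, Complex.ofReal_re]; ring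
  rw [hval] at hre
  refine hre.congr' ?_
  have hQne : ∀ᶠ t in 𝓝[J \ {t₀}] t₀, Q t ≠ 0 :=
    (hQc.mono_left hsub).eventually_ne hQ0.ne'
  filter_upwards [hQne, self_mem_nhdsWithin] with t hQt ht
  have hdiff := pencil_difference hs (hker t₀ ht₀) (hker t ht.1)
  have hne : t - t₀ ≠ 0 := sub_ne_zero.2 ht.2
  -- The difference identity divided by t - t₀. As t → t₀ the only limits needed are those of w, μ
  -- and the slopes of the real and imaginary parts of s⁻¹ β_j.
  have hsum : ((slope μ t₀ t : ℝ) : ℂ) * Q t = ∑ i : Fin (n + 1), conj (v i) * w t i *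
      ((-2 * (slope (fun u => (s⁻¹ * β u i).im) t₀ t +
        μ t * slope (fun u => (s⁻¹ * β u i).re) t₀ t) : ℝ) : ℂ) := by
    simp only [slope_def_field]
    rw [div_eq_inv_mul, Complex.ofReal_mul, mul_assoc]
    simp only [Q, w]
    rw [hdiff, Finset.mul_sum]
    refine Finset.sum_congr rfl fun i _ => ?_
    push_cast
    ring
  simp only [Function.comp_apply]
  rw [← hsum, mul_comm, mul_assoc, mul_inv_cancel₀ hQt, mul_one, Complex.ofReal_re]

/-- Expresses μ as a Rayleigh quotient; when the Hermitian part is positive definite, the sign of μ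
is then governed by K. -/
theorem pencil_rayleigh {β : ℕ → ℂ} {μ : ℝ} {v : Fin (n + 1) → ℂ} (hv : IsPencilKernel s β μ v) :
    2 * (star v ⬝ᵥ (matK n s β)ᵀ *ᵥ v) =
      μ * (star v ⬝ᵥ ((matA n s β)ᵀ + (matA n s β)ᵀᴴ) *ᵥ v) := by
  rw [isPencilKernel_iff, transpose_smul, smul_mulVec] at hv
  have := congrArg (fun u => star v ⬝ᵥ u) hv
  simpa [dotProduct_smul] using this

theorem pencil_eigenvalue_pos {β : ℕ → ℂ} {μ : ℝ} {v : Fin (n + 1) → ℂ} (hv0 : v ≠ 0)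
    (hv : IsPencilKernel s β μ v) (hH : ((matA n s β)ᵀ + (matA n s β)ᵀᴴ).PosDef)
    (hK : (matK n s β).PosDef) : 0 < μ := by
  have h1 := hH.dotProduct_mulVec_pos hv0
  have h2 := hK.transpose.dotProduct_mulVec_pos hv0
  have h3 := pencil_rayleigh hv
  have h4 := congrArg Complex.re h3
  rw [Complex.re_ofReal_mul] at h4
  have h5 := (Complex.pos_iff.1 h1).1
  have h6 := (Complex.pos_iff.1 h2).1
  simp only [Complex.mul_re, Complex.re_ofNat, Complex.im_ofNat, zero_mul, sub_zero] at h4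
  by_contra hcon
  push Not at hcon
  nlinarith [mul_nonneg (neg_nonneg.2 hcon) h5.le]

theorem pencil_eigenvalue_neg {β : ℕ → ℂ} {μ : ℝ} {v : Fin (n + 1) → ℂ} (hv0 : v ≠ 0)
    (hv : IsPencilKernel s β μ v) (hH : ((matA n s β)ᵀ + (matA n s β)ᵀᴴ).PosDef)
    (hK : (-matK n s β).PosDef) : μ < 0 := by
  have h1 := hH.dotProduct_mulVec_pos hv0
  have h2 := hK.transpose.dotProduct_mulVec_pos hv0
  have h3 := pencil_rayleigh hv
  have h4 := congrArg Complex.re h3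
  rw [Complex.re_ofReal_mul] at h4
  rw [transpose_neg, neg_mulVec, dotProduct_neg] at h2
  have h5 := (Complex.pos_iff.1 h1).1
  have h6 := (Complex.pos_iff.1 h2).1
  rw [Complex.neg_re] at h6
  simp only [Complex.mul_re, Complex.re_ofNat, Complex.im_ofNat, zero_mul, sub_zero] at h4
  by_contra hcon
  push Not at hcon
  nlinarith [mul_nonneg hcon h5.le]

end Pencil

end POPUC

namespace POPUC
open Matrix Filter Topology

/-! ### Eigenvalue angles and their velocities -/

section Main

variable {n : ℕ}

theorem continuousAt_matrix_inv {N : Matrix (Fin (n + 1)) (Fin (n + 1)) ℂ} (hN : IsUnit N) :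
    ContinuousAt (fun M : Matrix (Fin (n + 1)) (Fin (n + 1)) ℂ => M⁻¹) N := by
  have hd : N.det ≠ 0 := isUnit_iff_ne_zero.1 ((isUnit_iff_isUnit_det _).1 hN)
  have h1 : (fun M : Matrix (Fin (n + 1)) (Fin (n + 1)) ℂ => M⁻¹) =
      fun M => (M.det)⁻¹ • M.adjugate := by
    ext1 M; rw [inv_def, Ring.inverse_eq_inv']
  rw [h1]
  exact ((continuous_id.matrix_det).continuousAt.inv₀ hd).smul
    (continuous_id.matrix_adjugate).continuousAt

theorem continuousAt_det_sub_cayley {G : ℝ → Matrix (Fin (n + 1)) (Fin (n + 1)) ℂ} {ζ : ℂ} {t : ℝ}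
    (hG : ContinuousAt G t) (hN : IsUnit (1 - conj ζ • G t)) (x : ℂ) :
    ContinuousAt (fun u => (x • 1 - cayley ζ (G u)).det) t := by
  have h1 : Continuous fun M : Matrix (Fin (n + 1)) (Fin (n + 1)) ℂ => 1 - conj ζ • M := by
    fun_prop
  have h2 : Continuous fun M : Matrix (Fin (n + 1)) (Fin (n + 1)) ℂ =>
      (x • 1 - (-Complex.I) • ((2 : ℂ) • M - 1)).det := Continuous.matrix_det (by fun_prop)
  exact (h2.continuousAt.comp ((continuousAt_matrix_inv hN).comp_of_eq h1.continuousAt rfl)).comp hG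

/-- The point of the circle with Cayley transform `μ` has the angle `arg ζ + π - 2 arctan μ`. -/
theorem exp_angle {ζ : ℂ} (hζ : ‖ζ‖ = 1) (μ : ℝ) :
    Complex.exp (((Complex.arg ζ + Real.pi - 2 * Real.arctan μ : ℝ) : ℂ) * Complex.I) =
      ζ * (1 - 2 / (1 + Complex.I * μ)) := by
  have h1 : Complex.exp ((Complex.arg ζ : ℂ) * Complex.I) = ζ := by
    have := Complex.norm_mul_exp_arg_mul_I ζ
    rwa [hζ, Complex.ofReal_one, one_mul] at this
  have h2 : Complex.exp ((Real.arctan μ : ℂ) * Complex.I) =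
      (1 + Complex.I * μ) / (Real.sqrt (1 + μ ^ 2) : ℂ) := by
    rw [Complex.exp_mul_I, ← Complex.ofReal_cos, ← Complex.ofReal_sin, Real.cos_arctan,
      Real.sin_arctan]
    push_cast; ring
  have hne := one_add_I_mul_ne_zero μ
  have hpos : 0 < 1 + μ ^ 2 := by positivity
  have hsq : (Real.sqrt (1 + μ ^ 2) : ℂ) ^ 2 = 1 + (μ : ℂ) ^ 2 := by
    rw [← Complex.ofReal_pow, Real.sq_sqrt hpos.le]; push_cast; ring
  have hsq0 : (Real.sqrt (1 + μ ^ 2) : ℂ) ≠ 0 :=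
    Complex.ofReal_ne_zero.2 (Real.sqrt_pos.2 hpos).ne'
  have h3 : (((Complex.arg ζ + Real.pi - 2 * Real.arctan μ : ℝ) : ℂ) * Complex.I) =
      (Complex.arg ζ : ℂ) * Complex.I + Real.pi * Complex.I -
        ((Real.arctan μ : ℂ) * Complex.I + (Real.arctan μ : ℂ) * Complex.I) := by
    push_cast; ring
  rw [h3, Complex.exp_sub, Complex.exp_add, Complex.exp_add, h1, h2, Complex.exp_pi_mul_I]
  field_simp
  rw [hsq]
  linear_combination -ζ * (μ : ℂ) ^ 2 * Complex.I_sq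

/-- The summand at index 0 is strictly positive because the kernel vector is normalized to have
first entry 1. -/
theorem sum_normSq_kerVec_mul_pos {s : ℂ} {β : ℕ → ℂ} {μ : ℝ} {f : ℕ → ℝ} (hf : ∀ j ≤ n, 0 < f j) :
    0 < ∑ i : Fin (n + 1), Complex.normSq (kerVec s β μ (i + 1)) * f i := by
  have h1 : ∀ i : Fin (n + 1), 0 < f i := fun i => hf i (Nat.lt_succ_iff.1 i.2)
  refine Finset.sum_pos' (fun i _ => mul_nonneg (Complex.normSq_nonneg _) (h1 i).le)
    ⟨0, Finset.mem_univ _, ?_⟩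
  simpa [kerVec] using h1 0

/-- Differentiable eigenvalue arguments, whose velocities have the sign of `y_j + μ x_j`. -/
theorem exists_eigenvalueArgument (n : ℕ) (α : ℕ → ℝ → ℂ) (τ : ℝ → ℂ)
    (hα : ∀ j < n, ∀ t, ‖α j t‖ < 1) (hτ : ∀ t, ‖τ t‖ = 1)
    (hG : ∀ i k, Differentiable ℝ fun t => hessenberg n (fun j => α j t) (τ t) i k)
    (ζ s : ℂ) (hζ : ‖ζ‖ = 1) (hs : s ^ 2 = ζ) (c : ℝ → ℝ) (hc0 : ∀ t, 0 < c t)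
    (β : ℝ → ℕ → ℂ) (hβ : ∀ t, β t = beta n (fun j => α j t) (τ t) ζ s (c t))
    (J : Set ℝ) (hreg : ∀ t ∈ J, ζ ∉ spectrum ℂ (hessenberg n (fun j => α j t) (τ t)))
    (hx : ∀ t ∈ J, ∀ j ≤ n, xDeriv s β j t ≠ 0) (hy : ∀ t ∈ J, ∀ j ≤ n, yDeriv s β j t ≠ 0) :
    ∃ θ : Fin (n + 1) → ℝ → ℝ,
      (∀ t ∈ J, (hessenberg n (fun j => α j t) (τ t)).charpoly =
        ∏ j, (Polynomial.X - Polynomial.C (Complex.exp ((θ j t : ℂ) * Complex.I)))) ∧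
      ∀ k, ∀ t ∈ J, ∃ μ θ' : ℝ, HasDerivWithinAt (θ k) θ' J t ∧
        (t ∈ Kpos n s β → 0 < μ) ∧ (t ∈ Kneg n s β → μ < 0) ∧
        ((∀ j ≤ n, 0 < yDeriv s β j t + μ * xDeriv s β j t) → 0 < θ') ∧
        ((∀ j ≤ n, yDeriv s β j t + μ * xDeriv s β j t < 0) → θ' < 0) := by
  have hsn : ‖s‖ = 1 := by
    have : ‖s‖ ^ 2 = 1 := by rw [← norm_pow, hs, hζ]
    exact (pow_eq_one_iff_of_nonneg (norm_nonneg s) two_ne_zero).1 this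
  have hs0 : s ≠ 0 := by rintro rfl; simp at hsn
  set G : ℝ → Matrix (Fin (n + 1)) (Fin (n + 1)) ℂ := fun t => hessenberg n (fun j => α j t) (τ t)
    with hGdef
  have hGc : Continuous G := continuous_matrix fun i k => (hG i k).continuous
  have hN : ∀ t ∈ J, IsUnit (1 - conj ζ • G t) := fun t ht => isUnit_of_notMem_spectrum hζ (hreg t ht)
  have hdata : ∀ t ∈ J, ((matA n s (β t))ᵀ + (matA n s (β t))ᵀᴴ).PosDef ∧
      ∃ μ : Fin (n + 1) → ℝ, StrictMono μ ∧
      (∀ k, IsPencilKernel s (β t) (μ k) fun i : Fin (n + 1) => kerVec s (β t) (μ k) (i + 1)) ∧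
      (∀ x : ℂ, (x • 1 - cayley ζ (G t)).det = ∏ k, (x - μ k)) ∧
      (G t).charpoly = ∏ k, (Polynomial.X - Polynomial.C (ζ * (1 - 2 / (1 + Complex.I * μ k)))) := by
    intro t ht
    obtain ⟨U, X, hX, hU, hB, hXX⟩ := exists_congruence (fun j hj => hα j hj t) (hτ t) hζ hs
      (hreg t ht) (hc0 t)
    rw [← hβ t] at hB
    refine ⟨?_, exists_spectral_data (hessenberg_mul_conjTranspose (fun j hj => hα j hj t) (hτ t))
      hζ hs0 (hN t ht) hX hU hB hXX⟩
    rw [← hB, ← hXX]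
    exact PosDef.mul_conjTranspose_self X (vecMul_injective_of_isUnit hX)
  have hdata' : ∀ t, ∃ μ : Fin (n + 1) → ℝ, t ∈ J → StrictMono μ ∧
      (∀ k, IsPencilKernel s (β t) (μ k) fun i : Fin (n + 1) => kerVec s (β t) (μ k) (i + 1)) ∧
      (∀ x : ℂ, (x • 1 - cayley ζ (G t)).det = ∏ k, (x - μ k)) ∧
      (G t).charpoly = ∏ k, (Polynomial.X - Polynomial.C (ζ * (1 - 2 / (1 + Complex.I * μ k)))) := by
    intro t
    by_cases ht : t ∈ J
    · obtain ⟨μ, hμ⟩ := (hdata t ht).2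
      exact ⟨μ, fun _ => hμ⟩
    · exact ⟨0, fun h => absurd h ht⟩
  choose μ hμ using hdata'
  refine ⟨fun k t => Complex.arg ζ + Real.pi - 2 * Real.arctan (μ t k), ?_, ?_⟩
  · intro t ht
    rw [(hμ t ht).2.2.2]
    exact Finset.prod_congr rfl fun k _ => by rw [exp_angle hζ]
  intro k t ht
  have hcont : ContinuousWithinAt (fun u => μ u k) J t :=
    continuousWithinAt_sorted_roots (P := fun u x => (x • 1 - cayley ζ (G u)).det) ht
      (fun u hu => (hμ u hu).1) (fun u hu x => (hμ u hu).2.2.1 x)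
      (fun x => (continuousAt_det_sub_cayley hGc.continuousAt (hN t ht) x).continuousWithinAt) k
  have hker := (hμ t ht).2.1 k
  have hH := (hdata t ht).1
  have hv0 : (fun i : Fin (n + 1) => kerVec s (β t) (μ t k) (i + 1)) ≠ 0 := by
    intro h; have := congrFun h 0; simp [kerVec] at this
  -- `deriv` is 0 where a function is not differentiable, so the nonvanishing of x_j and y_j
  -- supplies the differentiability of s⁻¹ β_j.
  obtain ⟨q, hq, hderiv⟩ := hasDerivWithinAt_pencil hsn ht
    (fun j hj => (differentiableAt_of_deriv_ne_zero (hx t ht j hj)).hasDerivAt)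
    (fun j hj => (differentiableAt_of_deriv_ne_zero (hy t ht j hj)).hasDerivAt)
    hcont (fun u hu => (hμ u hu).2.1 k) hH
  have hθ := (hderiv.arctan.const_mul 2).const_sub (Complex.arg ζ + Real.pi)
  have hden : 0 < 1 + μ t k ^ 2 := by positivity
  refine ⟨μ t k, _, hθ, fun h => pencil_eigenvalue_pos hv0 hker hH h,
    fun h => pencil_eigenvalue_neg hv0 hker hH h, ?_, ?_⟩
  · intro h
    have h1 := mul_pos hq (sum_normSq_kerVec_mul_pos (s := s) (β := β t) (μ := μ t k) h)
    rw [neg_pos, mul_neg, mul_neg, neg_neg_iff_pos]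
    exact mul_pos two_pos (mul_pos (one_div_pos.2 hden) h1)
  · intro h
    have h1 := mul_pos hq (sum_normSq_kerVec_mul_pos (s := s) (β := β t) (μ := μ t k)
      (f := fun j => -(yDeriv s β j t + μ t k * xDeriv s β j t)) fun j hj => neg_pos.2 (h j hj))
    simp only [mul_neg, Finset.sum_neg_distrib] at h1
    rw [neg_neg_iff_pos]
    exact mul_pos two_pos (mul_pos (one_div_pos.2 hden) h1)

theorem uniqueDiffWithinAt_of_ordConnected {J : Set ℝ} (hJ : J.OrdConnected) (hJ' : J.Nontrivial)
    {t : ℝ} (ht : t ∈ J) : UniqueDiffWithinAt ℝ J t := by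
  obtain ⟨a, ha, b, hb, hab⟩ := hJ'.exists_lt
  have h1 : Set.Ioo a b ⊆ interior J :=
    interior_maximal (Set.Ioo_subset_Icc_self.trans (hJ.out ha hb)) isOpen_Ioo
  exact uniqueDiffWithinAt_convex hJ.convex ((Set.nonempty_Ioo.2 hab).mono h1) (subset_closure ht)

theorem moveCounterclockwiseOn_of_hasDerivWithinAt {m : ℕ} {M : ℝ → Matrix (Fin m) (Fin m) ℂ}
    {J : Set ℝ} (hJ : J.OrdConnected) (hJ' : J.Nontrivial) {θ : Fin m → ℝ → ℝ}
    (hM : ∀ t ∈ J, (M t).charpoly =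
      ∏ j, (Polynomial.X - Polynomial.C (Complex.exp ((θ j t : ℂ) * Complex.I))))
    (hθ : ∀ k, ∀ t ∈ J, ∃ θ' > 0, HasDerivWithinAt (θ k) θ' J t) :
    MoveCounterclockwiseOn M J := by
  have hd : ∀ k, DifferentiableOn ℝ (θ k) J := fun k t ht =>
    (hθ k t ht).choose_spec.2.differentiableWithinAt
  have hpos : ∀ k, ∀ t ∈ J, 0 < derivWithin (θ k) J t := by
    intro k t ht
    obtain ⟨θ', h0, h1⟩ := hθ k t ht
    rwa [h1.derivWithin (uniqueDiffWithinAt_of_ordConnected hJ hJ' ht)]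
  refine ⟨θ, ⟨hd, hM⟩, fun k => ⟨?_, hpos k⟩⟩
  refine strictMonoOn_of_deriv_pos hJ.convex (hd k).continuousOn fun t ht => ?_
  rw [← derivWithin_of_mem_nhds (mem_interior_iff_mem_nhds.1 ht)]
  exact hpos k t (interior_subset ht)

theorem moveClockwiseOn_of_hasDerivWithinAt {m : ℕ} {M : ℝ → Matrix (Fin m) (Fin m) ℂ}
    {J : Set ℝ} (hJ : J.OrdConnected) (hJ' : J.Nontrivial) {θ : Fin m → ℝ → ℝ}
    (hM : ∀ t ∈ J, (M t).charpoly =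
      ∏ j, (Polynomial.X - Polynomial.C (Complex.exp ((θ j t : ℂ) * Complex.I))))
    (hθ : ∀ k, ∀ t ∈ J, ∃ θ' < 0, HasDerivWithinAt (θ k) θ' J t) :
    MoveClockwiseOn M J := by
  have hd : ∀ k, DifferentiableOn ℝ (θ k) J := fun k t ht =>
    (hθ k t ht).choose_spec.2.differentiableWithinAt
  have hneg : ∀ k, ∀ t ∈ J, derivWithin (θ k) J t < 0 := by
    intro k t ht
    obtain ⟨θ', h0, h1⟩ := hθ k t ht
    rwa [h1.derivWithin (uniqueDiffWithinAt_of_ordConnected hJ hJ' ht)]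
  refine ⟨θ, ⟨hd, hM⟩, fun k => ⟨?_, hneg k⟩⟩
  refine strictAntiOn_of_deriv_neg hJ.convex (hd k).continuousOn fun t ht => ?_
  rw [← derivWithin_of_mem_nhds (mem_interior_iff_mem_nhds.1 ht)]
  exact hneg k t (interior_subset ht)

end Main

end POPUC

theorem mainTheorem3 (n : ℕ) (α : ℕ → ℝ → ℂ) (τ : ℝ → ℂ)
    (hα : ∀ j < n, ∀ t, ‖α j t‖ < 1) (hτ : ∀ t, ‖τ t‖ = 1)
    (hG : ∀ i k, Differentiable ℝ fun t => POPUC.hessenberg n (fun j => α j t) (τ t) i k)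
    (ζ s : ℂ) (hζ : ‖ζ‖ = 1) (hs : s ^ 2 = ζ)
    (c : ℝ → ℝ) (hc : Differentiable ℝ c) (hc0 : ∀ t, 0 < c t)
    (β : ℝ → ℕ → ℂ)
    (hβ : ∀ t, β t = POPUC.beta n (fun j => α j t) (τ t) ζ s (c t))
    (J : Set ℝ) (hJ : J.OrdConnected) (hJ' : J.Nontrivial)
    (hreg : ∀ t ∈ J, ζ ∉ spectrum ℂ (POPUC.hessenberg n (fun j => α j t) (τ t))) :
    (J ⊆ (POPUC.Ipp n s β ∩ POPUC.Kpos n s β) ∪ (POPUC.Imp n s β ∩ POPUC.Kneg n s β) →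
      POPUC.MoveCounterclockwiseOn (fun t => POPUC.hessenberg n (fun j => α j t) (τ t)) J) ∧
    (J ⊆ (POPUC.Imm n s β ∩ POPUC.Kpos n s β) ∪ (POPUC.Ipm n s β ∩ POPUC.Kneg n s β) →
      POPUC.MoveClockwiseOn (fun t => POPUC.hessenberg n (fun j => α j t) (τ t)) J) := by
  constructor
  · intro hsub
    obtain ⟨θ, hθ, hd⟩ := POPUC.exists_eigenvalueArgument n α τ hα hτ hG ζ s hζ hs c hc0 β hβ J hreg
      (fun t ht j hj => (hsub ht).elim (fun h => (h.1 j hj).1.ne') fun h => (h.1 j hj).1.ne)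
      (fun t ht j hj => (hsub ht).elim (fun h => (h.1 j hj).2.ne') fun h => (h.1 j hj).2.ne')
    refine POPUC.moveCounterclockwiseOn_of_hasDerivWithinAt hJ hJ' hθ fun k t ht => ?_
    obtain ⟨μ, θ', h1, hp, hn, hpos, -⟩ := hd k t ht
    refine ⟨θ', hpos fun j hj => ?_, h1⟩
    -- In either region μ and x_j have the same sign, so μ x_j reinforces the positive y_j.
    rcases hsub ht with h | h
    · exact add_pos (h.1 j hj).2 (mul_pos (hp h.2) (h.1 j hj).1)
    · exact add_pos (h.1 j hj).2 (mul_pos_of_neg_of_neg (hn h.2) (h.1 j hj).1)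
  · intro hsub
    obtain ⟨θ, hθ, hd⟩ := POPUC.exists_eigenvalueArgument n α τ hα hτ hG ζ s hζ hs c hc0 β hβ J hreg
      (fun t ht j hj => (hsub ht).elim (fun h => (h.1 j hj).1.ne) fun h => (h.1 j hj).1.ne')
      (fun t ht j hj => (hsub ht).elim (fun h => (h.1 j hj).2.ne) fun h => (h.1 j hj).2.ne)
    refine POPUC.moveClockwiseOn_of_hasDerivWithinAt hJ hJ' hθ fun k t ht => ?_
    obtain ⟨μ, θ', h1, hp, hn, -, hneg⟩ := hd k t ht
    refine ⟨θ', hneg fun j hj => ?_, h1⟩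
    -- Here μ and x_j have opposite signs, so μ x_j reinforces the negative y_j.
    rcases hsub ht with h | h
    · exact add_neg (h.1 j hj).2 (mul_neg_of_pos_of_neg (hp h.2) (h.1 j hj).1)
    · exact add_neg (h.1 j hj).2 (mul_neg_of_neg_of_pos (hn h.2) (h.1 j hj).1)
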